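/- An instance consists of a set $N$ of $n$ agents, a finite set $M$ of items, additive valuations $v_i:2^M\to\mathbb R$ ($i\in N$), and a partition of $M$ into $\ell$ (possibly empty) categories $C_1,\dots,C_\ell$, each with a lower and an upper quota $q_j^-,q_j^+\in\mathbb Z_{\ge 0}$ such that $q_j^- n\le |C_j|\le q_j^+ n$. It is an instance of goods (resp. of chores) if $v_i(g)\ge 0$ (resp. $v_i(g)\le 0$) for all $i\in N$ and $g\in M$; the agents are identical if $v_i=v_{i'}$ for all $i,i'\in N$. An allocation is an ordered partition $(A_i)_{i\in N}$ of $M$ into (possibly empty) bundles; it is feasible if $q_j^-\le |A_i\cap C_j|\le q_j^+$ for all $i\in N$ and $j\in\{1,\dots,\ell\}$. The maximin share of agent $i$ is $\mu_i=\max_P\min_{k\in N} v_i(P_k)$, the maximum being over all feasible allocations $P=(P_k)_{k\in N}$. For $\alpha\in\mathbb R$, an $\alpha$-MMS allocation is a feasible allocation $(A_i)_{i\in N}$ with $v_i(A_i)\ge\alpha\mu_i$ for all $i\in N$. The model of computation is the uniform cost model: a random access machine with memory cells for natural numbers and for real numbers, on which each addition, (truncated, for natural numbers) subtraction, comparison,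 conversion of a natural number to a real number, and memory access takes unit time, real numbers being used otherwise only in comparisons. The input consists of $\varepsilon$, $|M|$, the values $v_i(\{g\})$, the category of each item, and the quotas. **Theorem.** Let the number $n$ of agents and the number $\ell$ of categories be fixed. There is an algorithm that, given any real $\varepsilon>0$ and any instance of goods with $n$ identical agents and $\ell$ categories, computes a $(1-\varepsilon)$-MMS allocation in time polynomial in $|M|$ and $\varepsilon^{-1}$. Likewise, there is an algorithm that, given any real $\varepsilon>0$ and any instance of chores with $n$ identical agents and $\ell$ categories, computes a $(1+\varepsilon)$-MMS allocation in time polynomial in $|M|$ and $\varepsilon^{-1}$. -/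

import Mathlib

namespace QuotaMMS

noncomputable section

/-! ## Instances, feasible allocations and maximin shares -/

/-- An instance with agents `Fin n`, items `Fin m` and (possibly empty) categories indexed by
`Fin ℓ`. The partition of the items into categories is given by the category of each item, and an
additive valuation is given by its values on single items. -/
structure Instance (n m ℓ : ℕ) where
  value : Fin n → Fin m → ℝ
  category : Fin m → Fin ℓ
  lower : Fin ℓ → ℕ
  upper : Fin ℓ → ℕ
  lower_mul_le : ∀ j, lower j * n ≤ (Finset.univ.filter fun g => category g = j).card
  le_upper_mul : ∀ j, (Finset.univ.filter fun g => category g = j).card ≤ upper j * n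

/-- An allocation, that is, an ordered partition `(A_i)` of the items into `n` (possibly empty)
bundles, given by the agent who receives each item. -/
abbrev Allocation (n m : ℕ) := Fin m → Fin n

/-- The bundle `A_i` of agent `i`. -/
def Allocation.bundle {n m : ℕ} (A : Allocation n m) (i : Fin n) : Finset (Fin m) :=
  Finset.univ.filter fun g => A g = i

namespace Instance

variable {n m ℓ : ℕ}

/-- The category with index `j`, as a set of items. -/
def cat (I : Instance n m ℓ) (j : Fin ℓ) : Finset (Fin m) :=
  Finset.univ.filter fun g => I.category g = j

/-- The additive valuation of agent `i`. -/
def valuation (I : Instance n m ℓ) (i : Fin n) (S : Finset (Fin m)) : ℝ :=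
  ∑ g ∈ S, I.value i g

def FeasibleBundle (I : Instance n m ℓ) (S : Finset (Fin m)) : Prop :=
  ∀ j, I.lower j ≤ (S ∩ I.cat j).card ∧ (S ∩ I.cat j).card ≤ I.upper j

def Feasible (I : Instance n m ℓ) (A : Allocation n m) : Prop :=
  ∀ i, I.FeasibleBundle (A.bundle i)

def IsGoods (I : Instance n m ℓ) : Prop := ∀ i g, 0 ≤ I.value i g

def IsChores (I : Instance n m ℓ) : Prop := ∀ i g, I.value i g ≤ 0

/-- All agents have the same valuation. -/
def Identical (I : Instance n m ℓ) : Prop := ∀ i i', I.valuation i = I.valuation i'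

/-- The values `min_k v_i(P_k)` of all feasible allocations `P`. -/
def minValues (I : Instance n m ℓ) (i : Fin n) : Set ℝ :=
  {x | ∃ P : Allocation n m, I.Feasible P ∧ x = ⨅ k, I.valuation i (P.bundle k)}

/-- The maximin share of agent `i`; the supremum is a maximum by `isGreatest_mms`. -/
def mms (I : Instance n m ℓ) (i : Fin n) : ℝ := sSup (I.minValues i)

/-- `A` is an `α`-MMS allocation. -/
def IsApproxMMS (I : Instance n m ℓ) (α : ℝ) (A : Allocation n m) : Prop :=
  I.Feasible A ∧ ∀ i, α * I.mms i ≤ I.valuation i (A.bundle i)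

theorem exists_feasible (I : Instance n m ℓ) (hn : 0 < n) : ∃ A, I.Feasible A := by
  classical
  let e (g : Fin m) : ℕ :=
    ((Finset.univ.filter fun g' => I.category g' = I.category g ∧ g' < g)).card
  have hinj : ∀ g g', I.category g = I.category g' → e g = e g' → g = g' := by
    have key : ∀ g g', I.category g = I.category g' → g < g' → e g < e g' := by
      intro g g' hc hlt
      apply Finset.card_lt_card
      refine ⟨?_, ?_⟩
      · intro x hx
        simp only [Finset.mem_filter, Finset.mem_univ, true_and] at hx ⊢
        exact ⟨hx.1.trans hc, hx.2.trans hlt⟩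
      · intro hsub
        have : g ∈ Finset.univ.filter fun x => I.category x = I.category g ∧ x < g :=
          hsub (by simp [hc, hlt])
        simp at this
    intro g g' hc he
    rcases lt_trichotomy g g' with h | h | h
    · exact absurd he (key g g' hc h).ne
    · exact h
    · exact absurd he.symm (key g' g hc.symm h).ne
  have hlt : ∀ j, ∀ g ∈ I.cat j, e g < (I.cat j).card := by
    intro j g hg
    apply Finset.card_lt_card
    simp only [cat, Finset.mem_filter, Finset.mem_univ, true_and] at hg
    refine ⟨?_, ?_⟩
    · intro x hx
      simp only [cat, Finset.mem_filter, Finset.mem_univ, true_and] at hx ⊢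
      exact hx.1.trans hg
    · intro hsub
      have : g ∈ Finset.univ.filter fun x => I.category x = I.category g ∧ x < g :=
        hsub (by simp [cat, hg])
      simp at this
  have himg : ∀ j, (I.cat j).image e = Finset.range (I.cat j).card := by
    intro j
    apply Finset.eq_of_subset_of_card_le
    · intro x hx
      obtain ⟨g, hg, rfl⟩ := Finset.mem_image.1 hx
      exact Finset.mem_range.2 (hlt j g hg)
    · rw [Finset.card_range, Finset.card_image_of_injOn]
      intro g hg g' hg' h
      simp only [cat, Finset.coe_filter, Finset.mem_univ, true_and, Set.mem_ofPred_eq] at hg hg'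
      exact hinj g g' (hg.trans hg'.symm) h
  refine ⟨fun g => ⟨e g % n, Nat.mod_lt _ hn⟩, fun i j => ⟨?_, ?_⟩⟩
  · have hex : ∀ k ∈ Finset.range (I.lower j), ∃ g ∈ I.cat j, e g = k * n + i := by
      intro k hk
      have h1 := I.lower_mul_le j
      have h2 : k * n + i < (I.cat j).card := by
        have hk' : k + 1 ≤ I.lower j := Finset.mem_range.1 hk
        have h3 : (k + 1) * n ≤ I.lower j * n := Nat.mul_le_mul_right n hk'
        have h4 := i.2
        have h5 : (k + 1) * n = k * n + n := by ring
        unfold cat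
        omega
      have h6 : k * n + i ∈ (I.cat j).image e := by
        rw [himg]; exact Finset.mem_range.2 h2
      simpa using h6
    choose f' hf1' hf2' using hex
    by_cases hl : I.lower j = 0
    · simp [hl]
    obtain ⟨f, hf1, hf2⟩ : ∃ f : ℕ → Fin m, (∀ k ∈ Finset.range (I.lower j), f k ∈ I.cat j) ∧
        ∀ k ∈ Finset.range (I.lower j), e (f k) = k * n + i := by
      have h0 : 0 ∈ Finset.range (I.lower j) := Finset.mem_range.2 (Nat.pos_of_ne_zero hl)
      refine ⟨fun k => if h : k ∈ Finset.range (I.lower j) then f' k h else f' 0 h0, ?_, ?_⟩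
      · intro k hk
        simpa only [hk, dif_pos] using hf1' k hk
      · intro k hk
        simpa only [hk, dif_pos] using hf2' k hk
    have : (Finset.range (I.lower j)).card ≤
        (Allocation.bundle (fun g => (⟨e g % n, Nat.mod_lt _ hn⟩ : Fin n)) i ∩ I.cat j).card := by
      apply Finset.card_le_card_of_injOn f
      · intro k hk
        have hk' : k ∈ Finset.range (I.lower j) := hk
        simp only [Finset.coe_inter, Set.mem_inter_iff, Finset.mem_coe]
        refine ⟨?_, hf1 k hk'⟩
        simp only [Allocation.bundle, Finset.mem_filter, Finset.mem_univ, true_and]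
        ext
        simp [hf2 k hk', Nat.mod_eq_of_lt i.2]
      · intro k hk k' hk' h
        have h1 := hf2 k hk
        have h2 := hf2 k' hk'
        rw [h, h2] at h1
        exact (Nat.eq_of_mul_eq_mul_right hn (by omega))
    simpa using this
  · have : (Allocation.bundle (fun g => (⟨e g % n, Nat.mod_lt _ hn⟩ : Fin n)) i ∩ I.cat j).card ≤
        (Finset.range (I.upper j)).card := by
      apply Finset.card_le_card_of_injOn fun g => e g / n
      · intro g hg
        simp only [Finset.coe_inter, Set.mem_inter_iff, Finset.mem_coe] at hg
        have h1 := hlt j g hg.2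
        have h2 : (I.cat j).card ≤ I.upper j * n := I.le_upper_mul j
        simp only [Finset.coe_range, Set.mem_Iio]
        exact (Nat.div_lt_iff_lt_mul hn).2 (h1.trans_le h2)
      · intro g hg g' hg' h
        simp only [Finset.coe_inter, Set.mem_inter_iff, Finset.mem_coe, Allocation.bundle, cat,
          Finset.mem_filter, Finset.mem_univ, true_and] at hg hg'
        refine hinj g g' (hg.2.trans hg'.2.symm) ?_
        have h3 : e g % n = e g' % n := congrArg Fin.val (hg.1.trans hg'.1.symm)
        have h4 : e g / n = e g' / n := h
        rw [← Nat.div_add_mod (e g) n, ← Nat.div_add_mod (e g') n, h3, h4]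
    simpa using this

theorem isGreatest_mms (I : Instance n m ℓ) (i : Fin n) :
    IsGreatest (I.minValues i) (I.mms i) := by
  have hfin : (I.minValues i).Finite := by
    apply (Set.finite_range fun P : Allocation n m => ⨅ k, I.valuation i (P.bundle k)).subset
    rintro x ⟨P, -, rfl⟩
    exact ⟨P, rfl⟩
  have hne : (I.minValues i).Nonempty := by
    obtain ⟨A, hA⟩ := I.exists_feasible (Fin.pos i)
    exact ⟨_, A, hA, rfl⟩
  exact ⟨hne.csSup_mem hfin, fun x hx => le_csSup hfin.bddAbove hx⟩

end Instance

/-! ## Programs with unit-cost operations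

Imperative programs over a random access memory, in the uniform cost model. The memory consists
of arrays of natural numbers and arrays of real numbers; an array has a fixed name (a number), and
a cell of it is addressed by a list of natural numbers, so that a scalar variable is a cell with
the empty list of indices. The arithmetic operations are only addition and subtraction; real
numbers are otherwise used only in comparisons, and in particular cannot be rounded to natural
numbers. -/

structure Store where
  nat : ℕ → List ℕ → ℕ
  real : ℕ → List ℕ → ℝ

inductive NatExpr : Type
  | const (c : ℕ)
  /-- the cell of the array `a` with the given indices -/
  | get (a : ℕ) {k : ℕ} (idx : Fin k → NatExpr)
  | add (x y : NatExpr)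
  /-- truncated subtraction -/
  | sub (x y : NatExpr)

def NatExpr.eval (s : Store) : NatExpr → ℕ
  | .const c => c
  | .get a idx => s.nat a (List.ofFn fun j => (idx j).eval s)
  | .add x y => x.eval s + y.eval s
  | .sub x y => x.eval s - y.eval s

inductive RealExpr : Type
  | ofNat (x : NatExpr)
  | get (a : ℕ) {k : ℕ} (idx : Fin k → NatExpr)
  | add (x y : RealExpr)
  | sub (x y : RealExpr)

def RealExpr.eval (s : Store) : RealExpr → ℝ
  | .ofNat x => (x.eval s : ℝ)
  | .get a idx => s.real a (List.ofFn fun j => (idx j).eval s)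
  | .add x y => x.eval s + y.eval s
  | .sub x y => x.eval s - y.eval s

inductive Test : Type
  | natLe (x y : NatExpr)
  | realLe (x y : RealExpr)
  | not (b : Test)
  | and (b c : Test)

def Test.holds (s : Store) : Test → Prop
  | .natLe x y => x.eval s ≤ y.eval s
  | .realLe x y => x.eval s ≤ y.eval s
  | .not b => ¬ b.holds s
  | .and b c => b.holds s ∧ c.holds s

inductive Program : Type
  | skip
  | setNat (a : ℕ) {k : ℕ} (idx : Fin k → NatExpr) (x : NatExpr)
  | setReal (a : ℕ) {k : ℕ} (idx : Fin k → NatExpr) (x : RealExpr)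
  | seq (p q : Program)
  | ite (b : Test) (p q : Program)
  | loop (b : Test) (p : Program)

def Store.setNat (s : Store) (a : ℕ) (idx : List ℕ) (x : ℕ) : Store :=
  { s with nat := Function.update s.nat a (Function.update (s.nat a) idx x) }

def Store.setReal (s : Store) (a : ℕ) (idx : List ℕ) (x : ℝ) : Store :=
  { s with real := Function.update s.real a (Function.update (s.real a) idx x) }

/-- `Exec p s t s'`: the program `p`, started in the store `s`, halts in the store `s'` after `t`
steps. Each execution of an assignment and each evaluation of the test of a conditional or of a
loop is one step. (The expressions in a program have a fixed size, so that the number of single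
operations on the memory is at most a constant, depending only on the program, times `t`.) -/
inductive Exec : Program → Store → ℕ → Store → Prop
  | skip (s : Store) : Exec .skip s 1 s
  | setNat (a : ℕ) {k : ℕ} (idx : Fin k → NatExpr) (x : NatExpr) (s : Store) :
      Exec (.setNat a idx x) s 1
        (s.setNat a (List.ofFn fun j => (idx j).eval s) (x.eval s))
  | setReal (a : ℕ) {k : ℕ} (idx : Fin k → NatExpr) (x : RealExpr) (s : Store) :
      Exec (.setReal a idx x) s 1
        (s.setReal a (List.ofFn fun j => (idx j).eval s) (x.eval s))
  | seq {p q : Program} {s s' s'' : Store} {t t' : ℕ} :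
      Exec p s t s' → Exec q s' t' s'' → Exec (.seq p q) s (t + t') s''
  | ite_true {b : Test} {p q : Program} {s s' : Store} {t : ℕ} :
      b.holds s → Exec p s t s' → Exec (.ite b p q) s (t + 1) s'
  | ite_false {b : Test} {p q : Program} {s s' : Store} {t : ℕ} :
      ¬ b.holds s → Exec q s t s' → Exec (.ite b p q) s (t + 1) s'
  | loop_true {b : Test} {p : Program} {s s' s'' : Store} {t t' : ℕ} :
      b.holds s → Exec p s t s' → Exec (.loop b p) s' t' s'' →
        Exec (.loop b p) s (t + t' + 1) s''
  | loop_false {b : Test} {p : Program} {s : Store} :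
      ¬ b.holds s → Exec (.loop b p) s 1 s

/-! ## Input, output and running time -/

/-- The initial store on input `I` and `ε`. Arrays of natural numbers: `0` is the number of items,
`1` holds the category of each item, `2` and `3` hold the lower and the upper quota of each
category. Arrays of real numbers: `0` is `ε`, and `1` holds the value of each item for each agent.
All other cells are zero. -/
def inputStore {n m ℓ : ℕ} (I : Instance n m ℓ) (ε : ℝ) : Store where
  nat
    | 0, [] => m
    | 1, [g] => if h : g < m then I.category ⟨g, h⟩ else 0
    | 2, [j] => if h : j < ℓ then I.lower ⟨j, h⟩ else 0
    | 3, [j] => if h : j < ℓ then I.upper ⟨j, h⟩ else 0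
    | _, _ => 0
  real
    | 0, [] => ε
    | 1, [i, g] => if h : i < n ∧ g < m then I.value ⟨i, h.1⟩ ⟨g, h.2⟩ else 0
    | _, _ => 0

/-- In the store `s` the array `4` of natural numbers holds, for each item, its agent under `A`. -/
def Store.Outputs {n m : ℕ} (s : Store) (A : Allocation n m) : Prop :=
  ∀ g : Fin m, s.nat 4 [(g : ℕ)] = (A g : ℕ)

/-- On input `I` and `ε`, the program `p` halts after at most `T` steps and outputs an `α`-MMS
allocation for `I`. -/
def Program.ComputesMMS {n m ℓ : ℕ} (p : Program) (I : Instance n m ℓ) (ε α T : ℝ) : Prop :=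
  ∃ (t : ℕ) (s : Store) (A : Allocation n m),
    Exec p (inputStore I ε) t s ∧ (t : ℝ) ≤ T ∧ s.Outputs A ∧ I.IsApproxMMS α A

end

end QuotaMMS

namespace QuotaMMS

/-! ## A program logic with running times -/

/-! The algorithm is a dynamic program over rounded values, and one program serves goods and chores
because it rounds absolute values. Fix a natural number `N` with `N * ε ≥ m`. For a guessed item of
absolute value `B`, every item of absolute value `x` gets the rounded value `⌊N x / B⌋`, capped at
`m * N + 1`. A partial allocation of the first items is summarized by its features: the guess, the
number of allocated items, and for each agent the rounded value and the number of items per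
category. A feature vector has `2 + n (ℓ + 1)` entries, each polynomially bounded in `m` and `N`, so
for fixed `n` and `ℓ` there are polynomially many of them (`Queue.size_le`). The features after one
more item depend only on the old features (`features_succ`), so one representative per vector is
enough: for every allocation `P` and every guess, some stored allocation has the same features as
`P` (`present_features`). In particular it is feasible if `P` is. Among the stored complete feasible
allocations, the one with the largest exact minimum bundle value is the output.

For the guarantee, let `P` attain the maximin share `μ`. For goods the right guess is the most
valuable item in a bundle of `P` of value exactly `μ`; then `B ≤ μ ≤ m B`. A bundle with a capped
item is certainly worth `μ`; in any other bundle rounding loses at most `B / N` per item, in total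
at most `m μ / N ≤ ε μ` (`goods_guarantee`). For chores the right guess is the worst item of all;
some bundle contains it, so `B ≤ -μ`, and the rounding error is again at most `ε |μ|`
(`chores_guarantee`).

The remaining work is to run this on the machine model. `Runs` is a total-correctness logic with
step bounds, and `Frame` records which arrays a program leaves alone, so that each phase can be
analysed separately and the phases composed in `runs_mmsProgram`. -/

/-- The program `p`, started in `s`, halts after at most `T` steps in a store satisfying `Q`. -/
def Runs (p : Program) (s : Store) (T : ℕ) (Q : Store → Prop) : Prop :=
  ∃ t s', Exec p s t s' ∧ t ≤ T ∧ Q s'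

/-- The program contains an assignment to the array `a` of natural numbers. -/
def Program.ModNat (a : ℕ) : Program → Prop
  | .skip => False
  | .setNat b _ _ => a = b
  | .setReal _ _ _ => False
  | .seq p q => p.ModNat a ∨ q.ModNat a
  | .ite _ p q => p.ModNat a ∨ q.ModNat a
  | .loop _ p => p.ModNat a

/-- The program contains an assignment to the array `a` of real numbers. -/
def Program.ModReal (a : ℕ) : Program → Prop
  | .skip => False
  | .setNat _ _ _ => False
  | .setReal b _ _ => a = b
  | .seq p q => p.ModReal a ∨ q.ModReal a
  | .ite _ p q => p.ModReal a ∨ q.ModReal a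
  | .loop _ p => p.ModReal a

/-- The two stores agree on all arrays to which `p` does not assign. -/
def Frame (p : Program) (s s' : Store) : Prop :=
  (∀ a, ¬ p.ModNat a → s'.nat a = s.nat a) ∧ ∀ a, ¬ p.ModReal a → s'.real a = s.real a

theorem Frame.refl (p : Program) (s : Store) : Frame p s s := ⟨fun _ _ => rfl, fun _ _ => rfl⟩

theorem Frame.trans {p : Program} {s s' s'' : Store} (h : Frame p s s') (h' : Frame p s' s'') :
    Frame p s s'' :=
  ⟨fun a ha => (h'.1 a ha).trans (h.1 a ha), fun a ha => (h'.2 a ha).trans (h.2 a ha)⟩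

theorem Frame.mono {p q : Program} {s s' : Store} (h : Frame p s s')
    (h1 : ∀ a, p.ModNat a → q.ModNat a) (h2 : ∀ a, p.ModReal a → q.ModReal a) : Frame q s s' :=
  ⟨fun a ha => h.1 a fun hp => ha (h1 a hp), fun a ha => h.2 a fun hp => ha (h2 a hp)⟩

@[simp] theorem Store.setNat_nat (s : Store) (a : ℕ) (idx : List ℕ) (x b : ℕ) (k : List ℕ) :
    (s.setNat a idx x).nat b k = if b = a ∧ k = idx then x else s.nat b k := by
  by_cases h : b = a
  · subst h; simp [Store.setNat, Function.update_apply]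
  · simp [Store.setNat, h]

theorem Store.setNat_nat_of_ne (s : Store) {a b : ℕ} (idx : List ℕ) (x : ℕ) (h : b ≠ a) :
    (s.setNat a idx x).nat b = s.nat b := by
  simp [Store.setNat, h]

@[simp] theorem Store.setNat_real (s : Store) (a : ℕ) (idx : List ℕ) (x : ℕ) :
    (s.setNat a idx x).real = s.real := rfl

@[simp] theorem Store.setReal_real (s : Store) (a : ℕ) (idx : List ℕ) (x : ℝ) (b : ℕ)
    (k : List ℕ) :
    (s.setReal a idx x).real b k = if b = a ∧ k = idx then x else s.real b k := by
  by_cases h : b = a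
  · subst h; simp [Store.setReal, Function.update_apply]
  · simp [Store.setReal, h]

theorem Store.setReal_real_of_ne (s : Store) {a b : ℕ} (idx : List ℕ) (x : ℝ) (h : b ≠ a) :
    (s.setReal a idx x).real b = s.real b := by
  simp [Store.setReal, h]

@[simp] theorem Store.setReal_nat (s : Store) (a : ℕ) (idx : List ℕ) (x : ℝ) :
    (s.setReal a idx x).nat = s.nat := rfl

/-- The frame rule: since assignment targets are syntactic array names, preservation of all other
arrays never has to be put into an invariant. -/
theorem Exec.frame {p : Program} {s s' : Store} {t : ℕ} (h : Exec p s t s') : Frame p s s' := by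
  induction h with
  | skip s => exact Frame.refl _ _
  | setNat a idx x s => exact ⟨fun b hb => Store.setNat_nat_of_ne _ _ _ hb, fun _ _ => rfl⟩
  | setReal a idx x s => exact ⟨fun _ _ => rfl, fun b hb => Store.setReal_real_of_ne _ _ _ hb⟩
  | seq _ _ ih ih' =>
    exact (ih.mono (fun _ => Or.inl) (fun _ => Or.inl)).trans
      (ih'.mono (fun _ => Or.inr) (fun _ => Or.inr))
  | ite_true _ _ ih => exact ih.mono (fun _ => Or.inl) (fun _ => Or.inl)
  | ite_false _ _ ih => exact ih.mono (fun _ => Or.inr) (fun _ => Or.inr)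
  | loop_true _ _ _ ih ih' => exact Frame.trans (ih.mono (fun _ h => h) (fun _ h => h)) ih'
  | loop_false _ => exact Frame.refl _ _

/-- The consequence rule; besides weakening, it hands the frame of `p` to the proof of the new
postcondition. -/
theorem Runs.mono {p : Program} {s : Store} {T T' : ℕ} {Q Q' : Store → Prop}
    (h : Runs p s T Q) (hT : T ≤ T') (hQ : ∀ s', Frame p s s' → Q s' → Q' s') :
    Runs p s T' Q' := by
  obtain ⟨t, s', he, ht, hq⟩ := h
  exact ⟨t, s', he, ht.trans hT, hQ s' he.frame hq⟩

theorem Runs.skip {s : Store} {Q : Store → Prop} (h : Q s) : Runs .skip s 1 Q :=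
  ⟨1, s, .skip s, le_rfl, h⟩

theorem Runs.setNat {a k : ℕ} {idx : Fin k → NatExpr} {x : NatExpr} {s : Store}
    {Q : Store → Prop} (h : Q (s.setNat a (List.ofFn fun j => (idx j).eval s) (x.eval s))) :
    Runs (.setNat a idx x) s 1 Q :=
  ⟨1, _, .setNat a idx x s, le_rfl, h⟩

theorem Runs.setReal {a k : ℕ} {idx : Fin k → NatExpr} {x : RealExpr} {s : Store}
    {Q : Store → Prop} (h : Q (s.setReal a (List.ofFn fun j => (idx j).eval s) (x.eval s))) :
    Runs (.setReal a idx x) s 1 Q :=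
  ⟨1, _, .setReal a idx x s, le_rfl, h⟩

theorem Runs.seq {p q : Program} {s : Store} {T T' : ℕ} {Q : Store → Prop}
    (h : Runs p s T fun s' => Runs q s' T' Q) : Runs (.seq p q) s (T + T') Q := by
  obtain ⟨t, s', he, ht, t', s'', he', ht', hq⟩ := h
  exact ⟨t + t', s'', .seq he he', add_le_add ht ht', hq⟩

theorem Runs.ite {b : Test} {p q : Program} {s : Store} {T : ℕ} {Q : Store → Prop}
    (h : b.holds s → Runs p s T Q) (h' : ¬ b.holds s → Runs q s T Q) :
    Runs (.ite b p q) s (T + 1) Q := by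
  by_cases hb : b.holds s
  · obtain ⟨t, s', he, ht, hq⟩ := h hb
    exact ⟨t + 1, s', .ite_true hb he, by omega, hq⟩
  · obtain ⟨t, s', he, ht, hq⟩ := h' hb
    exact ⟨t + 1, s', .ite_false hb he, by omega, hq⟩

/-- The rule for loops: the body preserves `Inv` and decreases `f`. -/
theorem Runs.loop {b : Test} {p : Program} {T : ℕ} {Inv : Store → Prop} (f : Store → ℕ)
    {s₀ : Store} (step : ∀ s, Frame p s₀ s → Inv s → b.holds s →
      Runs p s T fun s' => Inv s' ∧ f s' < f s) {F : ℕ} (hF : f s₀ ≤ F) (h0 : Inv s₀) :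
    Runs (.loop b p) s₀ (F * (T + 1) + 1) fun s' => Inv s' ∧ ¬ b.holds s' := by
  suffices H : ∀ F s, Frame p s₀ s → f s ≤ F → Inv s →
      Runs (.loop b p) s (F * (T + 1) + 1) fun s' => Inv s' ∧ ¬ b.holds s' from
    H F s₀ (Frame.refl _ _) hF h0
  intro F
  induction F with
  | zero =>
    intro s hfr hf hs
    -- At measure `0` the test must fail, because a run of the body would decrease the measure
    -- further.
    have hb : ¬ b.holds s := by
      intro hb
      obtain ⟨_, s', _, _, -, h⟩ := step s hfr hs hb
      omega
    exact ⟨1, s, .loop_false hb, by omega, hs, hb⟩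
  | succ F ih =>
    intro s hfr hf hs
    by_cases hb : b.holds s
    · obtain ⟨t, s', he, ht, hi, hlt⟩ := step s hfr hs hb
      obtain ⟨t', s'', he', ht', hq⟩ := ih s' (hfr.trans he.frame) (by omega) hi
      refine ⟨t + t' + 1, s'', .loop_true hb he he', ?_, hq⟩
      have : (F + 1) * (T + 1) = F * (T + 1) + (T + 1) := by ring
      omega
    · exact ⟨1, s, .loop_false hb, by omega, hs, hb⟩

/-! ### Expressions and derived constructs -/

/-- The scalar variable `a`. -/
def NatExpr.var (a : ℕ) : NatExpr := .get a ![]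

def NatExpr.cell (a : ℕ) (x : NatExpr) : NatExpr := .get a ![x]

def NatExpr.cell₂ (a : ℕ) (x y : NatExpr) : NatExpr := .get a ![x, y]

def RealExpr.var (a : ℕ) : RealExpr := .get a ![]

def RealExpr.cell (a : ℕ) (x : NatExpr) : RealExpr := .get a ![x]

def RealExpr.cell₂ (a : ℕ) (x y : NatExpr) : RealExpr := .get a ![x, y]

section eval

variable (s : Store) (a : ℕ)

@[simp] theorem NatExpr.eval_const (c : ℕ) : (NatExpr.const c).eval s = c := by
  simp [NatExpr.eval]

@[simp] theorem NatExpr.eval_add (x y : NatExpr) :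
    (NatExpr.add x y).eval s = x.eval s + y.eval s := by simp [NatExpr.eval]

@[simp] theorem NatExpr.eval_sub (x y : NatExpr) :
    (NatExpr.sub x y).eval s = x.eval s - y.eval s := by simp [NatExpr.eval]

theorem NatExpr.eval_get {k : ℕ} (idx : Fin k → NatExpr) :
    (NatExpr.get a idx).eval s = s.nat a (List.ofFn fun j => (idx j).eval s) := by
  simp [NatExpr.eval]

@[simp] theorem NatExpr.eval_var : (NatExpr.var a).eval s = s.nat a [] := by
  simp [NatExpr.var, NatExpr.eval]

@[simp] theorem NatExpr.eval_cell (x : NatExpr) :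
    (NatExpr.cell a x).eval s = s.nat a [x.eval s] := by
  simp [NatExpr.cell, NatExpr.eval]

@[simp] theorem NatExpr.eval_cell₂ (x y : NatExpr) :
    (NatExpr.cell₂ a x y).eval s = s.nat a [x.eval s, y.eval s] := by
  simp [NatExpr.cell₂, NatExpr.eval]

@[simp] theorem RealExpr.eval_ofNat (x : NatExpr) : (RealExpr.ofNat x).eval s = x.eval s := by
  simp [RealExpr.eval]

@[simp] theorem RealExpr.eval_add (x y : RealExpr) :
    (RealExpr.add x y).eval s = x.eval s + y.eval s := by simp [RealExpr.eval]

@[simp] theorem RealExpr.eval_sub (x y : RealExpr) :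
    (RealExpr.sub x y).eval s = x.eval s - y.eval s := by simp [RealExpr.eval]

@[simp] theorem RealExpr.eval_var : (RealExpr.var a).eval s = s.real a [] := by
  simp [RealExpr.var, RealExpr.eval]

@[simp] theorem RealExpr.eval_cell (x : NatExpr) :
    (RealExpr.cell a x).eval s = s.real a [x.eval s] := by
  simp [RealExpr.cell, RealExpr.eval]

@[simp] theorem RealExpr.eval_cell₂ (x y : NatExpr) :
    (RealExpr.cell₂ a x y).eval s = s.real a [x.eval s, y.eval s] := by
  simp [RealExpr.cell₂, RealExpr.eval]

@[simp] theorem Test.holds_natLe (x y : NatExpr) :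
    (Test.natLe x y).holds s ↔ x.eval s ≤ y.eval s := Iff.rfl

@[simp] theorem Test.holds_realLe (x y : RealExpr) :
    (Test.realLe x y).holds s ↔ x.eval s ≤ y.eval s := Iff.rfl

@[simp] theorem Test.holds_not (b : Test) : b.not.holds s ↔ ¬ b.holds s := Iff.rfl

@[simp] theorem Test.holds_and (b c : Test) : (b.and c).holds s ↔ b.holds s ∧ c.holds s := Iff.rfl

/-- The conjunction of finitely many tests. -/
noncomputable def Test.all {α : Type*} [Fintype α] (f : α → Test) : Test :=
  (Finset.univ.toList.map f).foldr .and (.natLe (.const 0) (.const 0))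

@[simp] theorem Test.holds_all {α : Type*} [Fintype α] (f : α → Test) :
    (Test.all f).holds s ↔ ∀ x, (f x).holds s := by
  have H : ∀ l : List α, ((l.map f).foldr Test.and (.natLe (.const 0) (.const 0))).holds s ↔
      ∀ x ∈ l, (f x).holds s := by
    intro l
    induction l with
    | nil => simp
    | cons x l ih => simp [ih]
  simp [Test.all, H]

def Test.or (b c : Test) : Test := .not (.and (.not b) (.not c))

@[simp] theorem Test.holds_or (b c : Test) : (b.or c).holds s ↔ b.holds s ∨ c.holds s := by
  simp [Test.or]; tauto

def Test.natLt (x y : NatExpr) : Test := .not (.natLe y x)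

@[simp] theorem Test.holds_natLt (x y : NatExpr) :
    (Test.natLt x y).holds s ↔ x.eval s < y.eval s := by
  simp [Test.natLt]

/-- The disjunction of finitely many tests. -/
noncomputable def Test.any {α : Type*} [Fintype α] (f : α → Test) : Test :=
  .not (.all fun x => .not (f x))

@[simp] theorem Test.holds_any {α : Type*} [Fintype α] (f : α → Test) :
    (Test.any f).holds s ↔ ∃ x, (f x).holds s := by
  simp [Test.any]

end eval

namespace Program

def setVar (a : ℕ) (x : NatExpr) : Program := .setNat a ![] x

def setCell (a : ℕ) (x y : NatExpr) : Program := .setNat a ![x] y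

def setCell₂ (a : ℕ) (x y z : NatExpr) : Program := .setNat a ![x, y] z

def setRealVar (a : ℕ) (x : RealExpr) : Program := .setReal a ![] x

def setRealCell (a : ℕ) (x : NatExpr) (y : RealExpr) : Program := .setReal a ![x] y

def setRealCell₂ (a : ℕ) (x y : NatExpr) (z : RealExpr) : Program := .setReal a ![x, y] z

/-- Executes the body for the values `0, …, e - 1` of the variable `x`. -/
def forVar (x : ℕ) (e : NatExpr) (p : Program) : Program :=
  .seq (setVar x (.const 0))
    (.loop (.natLt (.var x) e) (.seq p (setVar x (.add (.var x) (.const 1)))))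

/-- Executes finitely many programs one after the other. -/
noncomputable def unroll {α : Type*} [Fintype α] (f : α → Program) : Program :=
  (Finset.univ.toList.map f).foldr .seq .skip

/-! ### Arrays assigned by the derived constructs -/

section mod

variable (a b : ℕ)

@[simp] theorem modNat_skip : ¬ Program.skip.ModNat a := id

@[simp] theorem modReal_skip : ¬ Program.skip.ModReal a := id

@[simp] theorem modNat_setNat {k : ℕ} (idx : Fin k → NatExpr) (x : NatExpr) :
    (Program.setNat b idx x).ModNat a ↔ a = b := Iff.rfl

@[simp] theorem modReal_setNat {k : ℕ} (idx : Fin k → NatExpr) (x : NatExpr) :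
    ¬ (Program.setNat b idx x).ModReal a := id

@[simp] theorem modNat_setReal {k : ℕ} (idx : Fin k → NatExpr) (x : RealExpr) :
    ¬ (Program.setReal b idx x).ModNat a := id

@[simp] theorem modReal_setReal {k : ℕ} (idx : Fin k → NatExpr) (x : RealExpr) :
    (Program.setReal b idx x).ModReal a ↔ a = b := Iff.rfl

@[simp] theorem modNat_seq (p q : Program) :
    (Program.seq p q).ModNat a ↔ p.ModNat a ∨ q.ModNat a := Iff.rfl

@[simp] theorem modReal_seq (p q : Program) :
    (Program.seq p q).ModReal a ↔ p.ModReal a ∨ q.ModReal a := Iff.rfl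

@[simp] theorem modNat_ite (t : Test) (p q : Program) :
    (Program.ite t p q).ModNat a ↔ p.ModNat a ∨ q.ModNat a := Iff.rfl

@[simp] theorem modReal_ite (t : Test) (p q : Program) :
    (Program.ite t p q).ModReal a ↔ p.ModReal a ∨ q.ModReal a := Iff.rfl

@[simp] theorem modNat_loop (t : Test) (p : Program) :
    (Program.loop t p).ModNat a ↔ p.ModNat a := Iff.rfl

@[simp] theorem modReal_loop (t : Test) (p : Program) :
    (Program.loop t p).ModReal a ↔ p.ModReal a := Iff.rfl

@[simp] theorem modNat_setVar (x : NatExpr) : (setVar b x).ModNat a ↔ a = b := Iff.rfl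

@[simp] theorem modReal_setVar (x : NatExpr) : ¬ (setVar b x).ModReal a := id

@[simp] theorem modNat_setCell (x y : NatExpr) : (setCell b x y).ModNat a ↔ a = b := Iff.rfl

@[simp] theorem modReal_setCell (x y : NatExpr) : ¬ (setCell b x y).ModReal a := id

@[simp] theorem modNat_setCell₂ (x y z : NatExpr) : (setCell₂ b x y z).ModNat a ↔ a = b := Iff.rfl

@[simp] theorem modReal_setCell₂ (x y z : NatExpr) : ¬ (setCell₂ b x y z).ModReal a := id

@[simp] theorem modNat_setRealVar (x : RealExpr) : ¬ (setRealVar b x).ModNat a := id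

@[simp] theorem modReal_setRealVar (x : RealExpr) : (setRealVar b x).ModReal a ↔ a = b := Iff.rfl

@[simp] theorem modNat_setRealCell (x : NatExpr) (y : RealExpr) :
    ¬ (setRealCell b x y).ModNat a := id

@[simp] theorem modReal_setRealCell (x : NatExpr) (y : RealExpr) :
    (setRealCell b x y).ModReal a ↔ a = b := Iff.rfl

@[simp] theorem modNat_setRealCell₂ (x y : NatExpr) (z : RealExpr) :
    ¬ (setRealCell₂ b x y z).ModNat a := id

@[simp] theorem modReal_setRealCell₂ (x y : NatExpr) (z : RealExpr) :
    (setRealCell₂ b x y z).ModReal a ↔ a = b := Iff.rfl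

@[simp] theorem modNat_forVar (x : ℕ) (e : NatExpr) (p : Program) :
    (forVar x e p).ModNat a ↔ a = x ∨ p.ModNat a := by
  simp [forVar]; tauto

@[simp] theorem modReal_forVar (x : ℕ) (e : NatExpr) (p : Program) :
    (forVar x e p).ModReal a ↔ p.ModReal a := by
  simp [forVar]

@[simp] theorem modNat_unroll {α : Type*} [Fintype α] (f : α → Program) :
    (unroll f).ModNat a ↔ ∃ x, (f x).ModNat a := by
  have H : ∀ l : List α, ((l.map f).foldr Program.seq .skip).ModNat a ↔
      ∃ x ∈ l, (f x).ModNat a := by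
    intro l
    induction l with
    | nil => simp
    | cons x l ih => simp [ih]
  simp [unroll, H]

@[simp] theorem modReal_unroll {α : Type*} [Fintype α] (f : α → Program) :
    (unroll f).ModReal a ↔ ∃ x, (f x).ModReal a := by
  have H : ∀ l : List α, ((l.map f).foldr Program.seq .skip).ModReal a ↔
      ∃ x ∈ l, (f x).ModReal a := by
    intro l
    induction l with
    | nil => simp
    | cons x l ih => simp [ih]
  simp [unroll, H]

end mod

end Program

open Program

/-! ### Rules for assignments to scalars and cells -/

section rules

variable {s : Store} {Q : Store → Prop} {a : ℕ}

theorem Runs.setVar {x : NatExpr} (h : Q (s.setNat a [] (x.eval s))) :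
    Runs (setVar a x) s 1 Q :=
  Runs.setNat (by simpa using h)

theorem Runs.setCell {x y : NatExpr} (h : Q (s.setNat a [x.eval s] (y.eval s))) :
    Runs (setCell a x y) s 1 Q :=
  Runs.setNat (by simpa using h)

theorem Runs.setCell₂ {x y z : NatExpr}
    (h : Q (s.setNat a [x.eval s, y.eval s] (z.eval s))) :
    Runs (setCell₂ a x y z) s 1 Q :=
  Runs.setNat (by simpa using h)

theorem Runs.setRealVar {x : RealExpr} (h : Q (s.setReal a [] (x.eval s))) :
    Runs (setRealVar a x) s 1 Q :=
  Runs.setReal (by simpa using h)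

theorem Runs.setRealCell {x : NatExpr} {y : RealExpr}
    (h : Q (s.setReal a [x.eval s] (y.eval s))) :
    Runs (setRealCell a x y) s 1 Q :=
  Runs.setReal (by simpa using h)

theorem Runs.setRealCell₂ {x y : NatExpr} {z : RealExpr}
    (h : Q (s.setReal a [x.eval s, y.eval s] (z.eval s))) :
    Runs (setRealCell₂ a x y z) s 1 Q :=
  Runs.setReal (by simpa using h)

end rules

/-- The rule for counting loops. The invariant must not depend on the counter `x`. -/
theorem Runs.forVar {x : ℕ} {e : NatExpr} {p : Program} {s₀ : Store} {T B : ℕ}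
    (Inv : ℕ → Store → Prop) (hx : ¬ p.ModNat x)
    (hInv : ∀ j s c, Inv j s → Inv j (s.setNat x [] c))
    (he : ∀ s, Frame (forVar x e p) s₀ s → e.eval s = B) (h0 : Inv 0 s₀)
    (step : ∀ j < B, ∀ s, Frame (Program.forVar x e p) s₀ s → s.nat x [] = j → Inv j s →
      Runs p s T (Inv (j + 1))) :
    Runs (forVar x e p) s₀ (B * (T + 2) + 2) (Inv B) := by
  have hset : ∀ s c, Frame (Program.forVar x e p) s (s.setNat x [] c) := fun s c =>
    ⟨fun a ha => Store.setNat_nat_of_ne _ _ _ (by rintro rfl; simp at ha), fun _ _ => rfl⟩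
  have hsub : ∀ s s', Frame p s s' → Frame (Program.forVar x e p) s s' := fun s s' h =>
    h.mono (fun a ha => by simp [ha]) (fun a ha => by simp [ha])
  -- One step sets the counter; each round costs the body, the increment and the test; the last step
  -- is the failing test.
  refine Runs.mono (T := 1 + (B * (T + 1 + 1) + 1)) (Q := Inv B) ?_ (by ring_nf; omega)
    (fun _ _ h => h)
  refine Runs.seq (Runs.setVar ?_)
  refine Runs.mono (Runs.loop
    (Inv := fun s => Frame (Program.forVar x e p) s₀ s ∧ s.nat x [] ≤ B ∧ Inv (s.nat x []) s)
    (fun s => B - s.nat x []) (T := T + 1) (F := B) ?_ (by simp) ?_) le_rfl ?_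
  · rintro s - ⟨hf, hle, hi⟩ hb
    simp only [Test.holds_natLt, NatExpr.eval_var, he s hf] at hb
    refine Runs.seq ((step _ hb s hf rfl hi).mono le_rfl ?_)
    intro s' hf' hi'
    refine Runs.setVar ?_
    have hxx : s'.nat x = s.nat x := hf'.1 x hx
    simp only [NatExpr.eval_add, NatExpr.eval_var, NatExpr.eval_const, Store.setNat_nat, and_self,
      if_true, hxx]
    exact ⟨⟨hf.trans ((hsub _ _ hf').trans (hset _ _)), hb, hInv _ _ _ hi'⟩, by omega⟩
  · exact ⟨hset _ _, by simp, by simpa using hInv _ _ _ h0⟩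
  · rintro s - ⟨⟨hf, hle, hi⟩, hb⟩
    simp only [Test.holds_natLt, NatExpr.eval_var, he s hf, not_lt] at hb
    rwa [← le_antisymm hle hb]

/-- The invariant is indexed by the set of elements already treated, so that the unspecified order
of `Finset.univ.toList` plays no role. -/
theorem Runs.unroll {α : Type*} [Fintype α] {f : α → Program} {s₀ : Store} {T : ℕ}
    (Inv : Set α → Store → Prop) (h0 : Inv ∅ s₀)
    (step : ∀ x D s, Frame (unroll f) s₀ s → Inv D s → Runs (f x) s T (Inv (insert x D))) :
    Runs (unroll f) s₀ (Fintype.card α * T + 1) (Inv Set.univ) := by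
  have hsub : ∀ x s s', Frame (f x) s s' → Frame (Program.unroll f) s s' := fun x s s' h =>
    h.mono (fun a ha => by simp only [modNat_unroll]; exact ⟨x, ha⟩)
      (fun a ha => by simp only [modReal_unroll]; exact ⟨x, ha⟩)
  have H : ∀ (l : List α) D s, Frame (Program.unroll f) s₀ s → Inv D s →
      Runs ((l.map f).foldr Program.seq .skip) s (l.length * T + 1)
        (Inv (D ∪ {x | x ∈ l})) := by
    intro l
    induction l with
    | nil => intro D s _ h; exact (Runs.skip (by simpa using h)).mono (by simp) (fun _ _ h => h)
    | cons x l ih =>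
      intro D s hf h
      refine Runs.mono (T := T + (l.length * T + 1)) (Q := Inv (D ∪ {y | y ∈ x :: l})) ?_
        (by simp; ring_nf; omega) (fun _ _ h => h)
      refine Runs.seq ((step x D s hf h).mono le_rfl fun s' hf' h' => ?_)
      have := ih _ s' (hf.trans (hsub _ _ _ hf')) h'
      convert this using 2
      ext y; simp; tauto
  have := H Finset.univ.toList ∅ s₀ (Frame.refl _ _) h0
  have h2 : (∅ ∪ {x | x ∈ (Finset.univ : Finset α).toList} : Set α) = Set.univ := by ext; simp
  rw [h2, Finset.length_toList, Finset.card_univ] at this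
  exact this

end QuotaMMS

namespace QuotaMMS

open Program

/-! ## Preprocessing

Arrays of natural numbers: `5` the precision `N`, `6` the cap, `7` the rounded values. Arrays of
real numbers: `2` multiples of `ε`, `3` absolute values, `4` and `5` multiples of absolute values.
-/

/-- The machine cannot multiply or divide, so `N * ε` and `m * N + 1` are built up by additions
while `N` is counted. -/
def scaleBody : Program :=
  .seq (setRealVar 2 (.add (.var 2) (.var 0)))
    (.seq (setVar 5 (.add (.var 5) (.const 1))) (setVar 6 (.add (.var 6) (.var 0))))

/-- Computes a number `N ≥ m / ε` and the cap `m * N + 1`. -/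
def scale : Program :=
  .seq (setRealVar 2 (.ofNat (.const 0))) (.seq (setVar 5 (.const 0)) (.seq (setVar 6 (.const 1))
    (.loop (.not (.realLe (.ofNat (.var 0)) (.var 2))) scaleBody)))

/-- While the loop runs, `N * ε < m`, which keeps `N` strictly below `⌈m / ε⌉₊`; this bounds the
number of rounds as well as the final `N`. -/
theorem runs_scale {s : Store} (hε : 0 < s.real 0 []) :
    Runs scale s (⌈(s.nat 0 [] : ℝ) / s.real 0 []⌉₊ * 4 + 4) fun s' =>
      s'.nat 5 [] ≤ ⌈(s.nat 0 [] : ℝ) / s.real 0 []⌉₊ ∧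
      s'.nat 6 [] = s.nat 0 [] * s'.nat 5 [] + 1 ∧
      (s.nat 0 [] : ℝ) ≤ s'.nat 5 [] * s.real 0 [] := by
  set m := s.nat 0 [] with hm
  set ε := s.real 0 [] with he
  set N₀ := ⌈(m : ℝ) / ε⌉₊ with hN
  refine Runs.mono (T := 1 + (1 + (1 + (N₀ * (3 + 1) + 1)))) ?_ (by omega) (fun _ _ h => h)
  refine Runs.seq (Runs.setRealVar (Runs.seq (Runs.setVar (Runs.seq (Runs.setVar ?_)))))
  refine (Runs.loop (Inv := fun s' => s'.nat 0 [] = m ∧ s'.real 0 [] = ε ∧ s'.nat 5 [] ≤ N₀ ∧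
    s'.nat 6 [] = m * s'.nat 5 [] + 1 ∧ s'.real 2 [] = s'.nat 5 [] * ε)
    (fun s => N₀ - s.nat 5 []) (T := 3) ?_ (F := N₀) (by simp) ?_).mono le_rfl ?_
  · rintro s' - ⟨h1, h2, h3, h4, h5⟩ hb
    simp only [Test.holds_not, Test.holds_realLe, RealExpr.eval_ofNat, NatExpr.eval_var, h1,
      RealExpr.eval_var, h5, not_le] at hb
    have hlt : s'.nat 5 [] < N₀ := by
      rw [hN, Nat.lt_ceil, lt_div_iff₀ hε]; exact hb
    refine Runs.mono (T := 1 + (1 + 1)) ?_ (by omega) (fun _ _ h => h)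
    refine Runs.seq (Runs.setRealVar (Runs.seq (Runs.setVar (Runs.setVar ?_))))
    simp [h1, h2, h4, h5]
    refine ⟨⟨hlt, by ring, by ring⟩, by omega⟩
  · simp [hm, he]
  · rintro s' - ⟨⟨h1, h2, h3, h4, h5⟩, hb⟩
    simp [h1, h5] at hb
    exact ⟨h3, h4, hb⟩

/-- Computes the absolute values of the items for the first agent. -/
def absValues : Program :=
  forVar 13 (.var 0) (.ite (.realLe (.ofNat (.const 0)) (.cell₂ 1 (.const 0) (.var 13)))
    (setRealCell 3 (.var 13) (.cell₂ 1 (.const 0) (.var 13)))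
    (setRealCell 3 (.var 13) (.sub (.ofNat (.const 0)) (.cell₂ 1 (.const 0) (.var 13)))))

theorem runs_absValues (s : Store) :
    Runs absValues s (s.nat 0 [] * 4 + 2) fun s' =>
      ∀ g < s.nat 0 [], s'.real 3 [g] = |s.real 1 [0, g]| := by
  refine Runs.forVar (B := s.nat 0 []) (T := 2)
    (fun j s' => ∀ g < j, s'.real 3 [g] = |s.real 1 [0, g]|) (by simp) ?_ ?_ (by simp) ?_
  · intro j s' c h; simpa using h
  · intro s' hf; simp [hf.1 0 (by simp)]
  · intro j hj s' hf hx hi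
    have hv : s'.real 1 = s.real 1 := hf.2 1 (by simp)
    refine Runs.ite (T := 1) (fun hb => Runs.setRealCell ?_) (fun hb => Runs.setRealCell ?_)
    · simp [hx, hv] at hb
      intro g hg
      by_cases h : g = j
      · simp [h, hx, hv, abs_of_nonneg hb]
      · simp [h, hx, hi g (by omega)]
    · simp [hx, hv] at hb
      intro g hg
      by_cases h : g = j
      · simp [h, hx, hv, abs_of_neg hb]
      · simp [h, hx, hi g (by omega)]

/-- `r` is the minimum of `c` and the rounded down quotient of `x` and `B / N`. -/
def IsRound (N c : ℕ) (B x : ℝ) (r : ℕ) : Prop :=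
  r ≤ c ∧ r * B ≤ N * x ∧ (r < c → N * x < (r + 1) * B)

/-- Rounds the value of the item with index in cell `14` in terms of the item with index in
cell `13`. -/
def roundCell : Program :=
  .seq (setRealVar 4 (.ofNat (.const 0)))
  (.seq (forVar 15 (.var 5) (setRealVar 4 (.add (.var 4) (.cell 3 (.var 14)))))
  (.seq (setVar 16 (.const 0))
  (.seq (setRealVar 5 (.cell 3 (.var 13)))
  (.seq (.loop (.and (.natLt (.var 16) (.var 6)) (.realLe (.var 5) (.var 4)))
    (.seq (setVar 16 (.add (.var 16) (.const 1)))
      (setRealVar 5 (.add (.var 5) (.cell 3 (.var 13))))))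
  (setCell₂ 7 (.var 13) (.var 14) (.var 16))))))

/-- The quotient is found by counting: `r` is raised as long as it is below the cap and `(r + 1) * B
≤ N * x`. The cap ensures termination even if `B = 0`, in which case `r` ends at the cap, and it
keeps the rounded values polynomial when `B` is tiny. -/
theorem runs_roundCell (s : Store) (h0 : 0 ≤ s.real 3 [s.nat 14 []]) :
    Runs roundCell s (s.nat 5 [] * 3 + s.nat 6 [] * 3 + 7) fun s' =>
      ∃ r, IsRound (s.nat 5 []) (s.nat 6 []) (s.real 3 [s.nat 13 []]) (s.real 3 [s.nat 14 []]) r ∧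
        s'.nat 7 [s.nat 13 [], s.nat 14 []] = r ∧ ∀ k, k ≠ [s.nat 13 [], s.nat 14 []] →
          s'.nat 7 k = s.nat 7 k := by
  set N := s.nat 5 [] with hN
  set c := s.nat 6 [] with hc
  set B := s.real 3 [s.nat 13 []] with hB
  set x := s.real 3 [s.nat 14 []] with hx
  refine Runs.mono (T := 1 + ((N * (1 + 2) + 2) + (1 + (1 + ((c * (2 + 1) + 1) + 1))))) ?_
    (by omega) (fun _ _ h => h)
  refine Runs.seq (Runs.setRealVar (Runs.seq (Runs.mono (Runs.forVar (B := N) (T := 1)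
    (fun j s' => s'.real 4 [] = j * x) (by simp) ?_ ?_ (by simp) ?_) le_rfl ?_)))
  · intro j s' v h; simpa using h
  · intro s' hf; simp [hf.1 5 (by simp), hN]
  · intro j hj s' hf _ h
    refine Runs.setRealVar ?_
    have h1 : s'.real 3 = s.real 3 := by
      rw [hf.2 3 (by simp)]; rw [Store.setReal_real_of_ne _ _ _ (by simp)]
    have h2 : s'.nat 14 = s.nat 14 := by rw [hf.1 14 (by simp)]; rfl
    simp [h, h1, h2, ← hx]; ring
  · intro s' hf h
    have h1 : s'.real 3 = s.real 3 := by
      rw [hf.2 3 (by simp)]; rw [Store.setReal_real_of_ne _ _ _ (by simp)]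
    have h13 : s'.nat 13 = s.nat 13 := by rw [hf.1 13 (by simp)]; rfl
    have h14 : s'.nat 14 = s.nat 14 := by rw [hf.1 14 (by simp)]; rfl
    have h6 : s'.nat 6 = s.nat 6 := by rw [hf.1 6 (by simp)]; rfl
    have h7 : s'.nat 7 = s.nat 7 := by rw [hf.1 7 (by simp)]; rfl
    refine Runs.seq (Runs.setVar (Runs.seq (Runs.setRealVar (Runs.seq (Runs.mono (Runs.loop
      -- Cell `5` runs one multiple of `B` ahead of `r`, so that the test compares the next
      -- candidate `(r + 1) * B` with `N * x`.
      (Inv := fun u => u.nat 16 [] ≤ c ∧ u.real 4 [] = N * x ∧ u.real 3 = s.real 3 ∧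
        u.nat 13 = s.nat 13 ∧ u.nat 14 = s.nat 14 ∧ u.nat 6 = s.nat 6 ∧ u.nat 7 = s.nat 7 ∧
        u.real 5 [] = (u.nat 16 [] + 1) * B ∧ u.nat 16 [] * B ≤ N * x)
      (fun u => c - u.nat 16 []) (T := 2) ?_ (F := c) (by simp) ?_) le_rfl ?_)))))
    · rintro u - ⟨i1, i2, i3, i4, i5, i6, i7, i8, i9⟩ hb
      simp [i6, ← hc, i2, i8] at hb
      refine Runs.mono (T := 1 + 1) (Runs.seq (Runs.setVar (Runs.setRealVar ?_))) le_rfl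
        (fun _ _ h => h)
      simp [i2, i3, i4, i5, i6, i7, i8, ← hB, Store.setReal_real_of_ne, Store.setNat_nat_of_ne]
      refine ⟨⟨hb.1, by ring, hb.2⟩, by omega⟩
    · simp [h, h1, h13, h14, h6, h7, ← hB, Store.setReal_real_of_ne, Store.setNat_nat_of_ne]
      positivity
    · rintro u - ⟨⟨i1, i2, i3, i4, i5, i6, i7, i8, i9⟩, hb⟩
      simp [i6, ← hc, i2, i8] at hb
      refine Runs.setCell₂ ⟨u.nat 16 [], ⟨i1, i9, hb⟩, ?_, ?_⟩
      · simp [i4, i5]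
      · intro k hk
        simp [i4, i5, i7, hk]

/-- Computes the rounded values. -/
def roundValues : Program := forVar 13 (.var 0) (forVar 14 (.var 0) roundCell)

theorem roundCell_modNat (a : ℕ) : roundCell.ModNat a ↔ a = 15 ∨ a = 16 ∨ a = 7 := by
  simp [roundCell]

theorem roundCell_modReal (a : ℕ) : roundCell.ModReal a ↔ a = 4 ∨ a = 5 := by
  simp [roundCell]

theorem runs_roundValues (s : Store) (h0 : ∀ g < s.nat 0 [], 0 ≤ s.real 3 [g]) :
    Runs roundValues s
      (s.nat 0 [] * (s.nat 0 [] * (s.nat 5 [] * 3 + s.nat 6 [] * 3 + 9) + 4) + 2) fun s' =>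
      ∀ g < s.nat 0 [], ∀ g' < s.nat 0 [],
        IsRound (s.nat 5 []) (s.nat 6 []) (s.real 3 [g]) (s.real 3 [g']) (s'.nat 7 [g, g']) := by
  set N := s.nat 5 [] with hN
  set c := s.nat 6 [] with hc
  set m := s.nat 0 [] with hm
  refine Runs.mono (T := m * ((m * ((N * 3 + c * 3 + 7) + 2) + 2) + 2) + 2)
    (Runs.forVar (B := m)
    (fun j s' => ∀ g < j, ∀ g' < m, IsRound N c (s.real 3 [g]) (s.real 3 [g']) (s'.nat 7 [g, g']))
    (by simp [roundCell_modNat]) ?_ ?_ (by simp) ?_) (by ring_nf; omega) (fun _ _ h => h)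
  · intro j s' v h; simpa using h
  · intro s' hf; simp [hf.1 0 (by simp [roundCell_modNat]), hm]
  · intro j hj s' hf hx hi
    have e0 : s'.nat 0 = s.nat 0 := hf.1 0 (by simp [roundCell_modNat])
    have e5 : s'.nat 5 = s.nat 5 := hf.1 5 (by simp [roundCell_modNat])
    have e6 : s'.nat 6 = s.nat 6 := hf.1 6 (by simp [roundCell_modNat])
    have e3 : s'.real 3 = s.real 3 := hf.2 3 (by simp [roundCell_modReal])
    refine Runs.mono (Runs.forVar (B := m) (T := N * 3 + c * 3 + 7)
      (fun i u => (∀ g < j, ∀ g' < m,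
        IsRound N c (s.real 3 [g]) (s.real 3 [g']) (u.nat 7 [g, g'])) ∧ ∀ g' < i,
        IsRound N c (s.real 3 [j]) (s.real 3 [g']) (u.nat 7 [j, g']))
      (by simp [roundCell_modNat]) ?_ ?_ (by simpa using hi) ?_) le_rfl ?_
    · intro i u v h; simpa using h
    · intro u hf'; simp [hf'.1 0 (by simp [roundCell_modNat]), hm, e0]
    · intro i hi' u hf' hy h
      have f5 : u.nat 5 = s.nat 5 := (hf'.1 5 (by simp [roundCell_modNat])).trans e5
      have f6 : u.nat 6 = s.nat 6 := (hf'.1 6 (by simp [roundCell_modNat])).trans e6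
      have f3 : u.real 3 = s.real 3 := (hf'.2 3 (by simp [roundCell_modReal])).trans e3
      have f13 : u.nat 13 [] = j := by rw [hf'.1 13 (by simp [roundCell_modNat]), hx]
      have := runs_roundCell u (by rw [f3, hy]; exact h0 i hi')
      rw [f5, f6, f3, f13, hy] at this
      refine this.mono le_rfl ?_
      rintro w - ⟨r, hr, hw, hw'⟩
      refine ⟨fun g hg g' hg' => ?_, fun g' hg' => ?_⟩
      · rw [hw' _ (by simp; omega)]; exact h.1 g hg g' hg'
      · by_cases hgi : g' = i
        · rw [hgi, hw]; exact hr
        · rw [hw' _ (by simp; omega)]; exact h.2 g' (by omega)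
    · rintro u - ⟨h1, h2⟩ g hg g' hg'
      by_cases hgj : g = j
      · rw [hgj]; exact h2 g' hg'
      · exact h1 g (by omega) g' hg'

end QuotaMMS

namespace QuotaMMS

open Program

/-! ## The dynamic program

Arrays of natural numbers: `8` the features of the states, `9` their allocations, `10` marks the
feature vectors of all states, `11` the number of states. Array `6` of real numbers: the values of
the bundles of the states. -/

/-- A state is a partial allocation of the first items; its features are the item in terms of which
the values are rounded (`inl false`), the number of allocated items (`inl true`), and for each agent
the rounded value of the bundle and the number of its items in each category. -/
abbrev Feature (n ℓ : ℕ) := Bool ⊕ (Fin n × Option (Fin ℓ))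

/-! ### Features and states -/

section states

variable {n ℓ : ℕ}

/-- Numbers the features, so that they can serve as cell indices. -/
noncomputable def Feature.code (c : Feature n ℓ) : ℕ := Fintype.equivFin _ c

theorem Feature.code_injective : Function.Injective (Feature.code : Feature n ℓ → ℕ) :=
  Fin.val_injective.comp (Fintype.equivFin _).injective

@[simp] theorem Feature.code_inj {c c' : Feature n ℓ} : c.code = c'.code ↔ c = c' :=
  Feature.code_injective.eq_iff

noncomputable def initFeature (g₀ : ℕ) : Feature n ℓ → ℕ
  | .inl false => g₀
  | _ => 0

/-- The increment of a feature when item `g`, rounded in terms of item `g₀`, is given to agent `i`.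
-/
def featureStep (cat R : List ℕ → ℕ) (g₀ g i : ℕ) : Feature n ℓ → ℕ
  | .inl false => 0
  | .inl true => 1
  | .inr (i', some j) => if (i' : ℕ) = i ∧ cat [g] = j then 1 else 0
  | .inr (i', none) => if (i' : ℕ) = i then R [g₀, g] else 0

/-- The features after item `f (inl true)` has been given to agent `i`. -/
def succFeature (cat R : List ℕ → ℕ) (f : Feature n ℓ → ℕ) (i : ℕ) (c : Feature n ℓ) : ℕ :=
  f c + featureStep cat R (f (.inl false)) (f (.inl true)) i c

/-- The features of the allocation `a` of the first `L` items. -/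
noncomputable def features (cat R : List ℕ → ℕ) (g₀ L : ℕ) (a : ℕ → ℕ) (c : Feature n ℓ) : ℕ :=
  initFeature g₀ c + ∑ g ∈ Finset.range L, featureStep cat R g₀ g (a g) c

variable (cat R : List ℕ → ℕ)

@[simp] theorem features_guess (g₀ L : ℕ) (a : ℕ → ℕ) :
    features (n := n) (ℓ := ℓ) cat R g₀ L a (.inl false) = g₀ := by
  simp [features, featureStep, initFeature]

@[simp] theorem features_level (g₀ L : ℕ) (a : ℕ → ℕ) :
    features (n := n) (ℓ := ℓ) cat R g₀ L a (.inl true) = L := by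
  simp [features, featureStep, initFeature]

/-- The principle behind the dynamic program: the new features depend on the earlier choices only
through the old features, because guess and level are themselves features. -/
theorem features_succ (g₀ L : ℕ) (a : ℕ → ℕ) :
    features (n := n) (ℓ := ℓ) cat R g₀ (L + 1) a =
      succFeature cat R (features cat R g₀ L a) (a L) := by
  funext c
  rw [succFeature, features_guess, features_level, features, features, Finset.sum_range_succ,
    add_assoc]

theorem features_congr (g₀ L : ℕ) {a b : ℕ → ℕ} (h : ∀ g < L, a g = b g) :
    features (n := n) (ℓ := ℓ) cat R g₀ L a = features cat R g₀ L b := by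
  funext c
  unfold features
  congr 1
  exact Finset.sum_congr rfl fun g hg => by rw [h g (Finset.mem_range.1 hg)]

/-- A single crude bound for all features: guess, level and item counts are at most `m`, and rounded
bundle values are sums of at most `m` terms bounded by `k`. -/
theorem features_le {m k g₀ L : ℕ} (a : ℕ → ℕ) (hk : 0 < k) (hg₀ : g₀ < m) (hL : L ≤ m)
    (hR : ∀ g < m, R [g₀, g] ≤ k) (c : Feature n ℓ) : features cat R g₀ L a c ≤ m * k := by
  have hmk : m ≤ m * k := Nat.le_mul_of_pos_right m hk
  have H : ∀ c : Feature n ℓ, (∀ g < m, featureStep cat R g₀ g (a g) c ≤ k) →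
      ∑ g ∈ Finset.range L, featureStep cat R g₀ g (a g) c ≤ m * k := by
    intro c hc
    calc ∑ g ∈ Finset.range L, featureStep cat R g₀ g (a g) c
        ≤ ∑ g ∈ Finset.range L, k :=
          Finset.sum_le_sum fun g hg => hc g ((Finset.mem_range.1 hg).trans_le hL)
      _ = L * k := by simp
      _ ≤ m * k := Nat.mul_le_mul_right k hL
  match c with
  | .inl false => rw [features_guess]; omega
  | .inl true => rw [features_level]; omega
  | .inr (i, some j) =>
    simp only [features, initFeature, zero_add]
    refine H _ fun g _ => ?_
    simp only [featureStep]; split_ifs <;> omega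
  | .inr (i, none) =>
    simp only [features, initFeature, zero_add]
    refine H _ fun g hg => ?_
    simp only [featureStep]; split_ifs
    · exact hR g hg
    · omega

/-- The features of the state `q`. -/
noncomputable def Store.feature (s : Store) (q : ℕ) (c : Feature n ℓ) : ℕ := s.nat 8 [q, c.code]

/-- The features of the state `q` as a list. -/
noncomputable def Store.key (n ℓ : ℕ) (s : Store) (q : ℕ) : List ℕ :=
  List.ofFn fun c : Fin (Fintype.card (Feature n ℓ)) => s.nat 8 [q, c]

theorem Store.key_eq_iff {s s' : Store} {q q' : ℕ} :
    s.key n ℓ q = s'.key n ℓ q' ↔ (s.feature q : Feature n ℓ → ℕ) = s'.feature q' := by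
  unfold Store.key
  rw [List.ofFn_inj]
  constructor
  · intro h; funext c; exact congrFun h (Fintype.equivFin _ c)
  · intro h; funext c
    have := congrFun h ((Fintype.equivFin _).symm c)
    simpa [Store.feature, Feature.code] using this

/-- The state `q` of the store `s` describes an allocation of the first items. -/
structure ValidState (cat R : List ℕ → ℕ) (v : List ℕ → ℝ) (m n ℓ : ℕ) (s : Store) (q : ℕ) :
    Prop where
  guess_lt : s.feature q (.inl false : Feature n ℓ) < m
  level_le : s.feature q (.inl true : Feature n ℓ) ≤ m
  agent_lt : ∀ g < s.feature q (.inl true : Feature n ℓ), s.nat 9 [q, g] < n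
  feature_eq : (s.feature q : Feature n ℓ → ℕ) =
    features cat R (s.feature q (.inl false : Feature n ℓ)) (s.feature q (.inl true : Feature n ℓ))
      fun g => s.nat 9 [q, g]
  value_eq : ∀ i : Fin n, s.real 6 [q, i] =
    ∑ g ∈ Finset.range (s.feature q (.inl true : Feature n ℓ)),
      if s.nat 9 [q, g] = i then v [0, g] else 0

/-- The state `q` of `s` is also the state `q` of `s'`. -/
def SameState (s s' : Store) (q : ℕ) : Prop :=
  ∀ x, s'.nat 8 [q, x] = s.nat 8 [q, x] ∧ s'.nat 9 [q, x] = s.nat 9 [q, x] ∧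
    s'.real 6 [q, x] = s.real 6 [q, x]

theorem SameState.feature {s s' : Store} {q : ℕ} (h : SameState s s' q) :
    (s'.feature q : Feature n ℓ → ℕ) = s.feature q := by
  funext c; exact (h _).1

theorem SameState.key {s s' : Store} {q : ℕ} (h : SameState s s' q) :
    s'.key n ℓ q = s.key n ℓ q :=
  Store.key_eq_iff.2 h.feature

variable {cat R} {v : List ℕ → ℝ} {m : ℕ}

theorem ValidState.congr {s s' : Store} {q : ℕ} (hv : ValidState cat R v m n ℓ s q)
    (h : SameState s s' q) : ValidState cat R v m n ℓ s' q := by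
  have hf : (s'.feature q : Feature n ℓ → ℕ) = s.feature q := h.feature
  obtain ⟨h1, h2, h3, h4, h5⟩ := hv
  constructor
  · rwa [hf]
  · rwa [hf]
  · intro g hg; rw [hf] at hg; rw [(h g).2.1]; exact h3 g hg
  · rw [hf, h4]; simp only [features_guess, features_level]
    exact features_congr _ _ _ _ fun g _ => ((h g).2.1).symm
  · intro i; rw [(h i).2.2, hf, h5]
    exact Finset.sum_congr rfl fun g _ => by rw [(h g).2.1]

/-- The invariant of the list of states. -/
structure Queue (cat R : List ℕ → ℕ) (v : List ℕ → ℝ) (m n ℓ : ℕ) (s : Store) : Prop where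
  valid : ∀ q < s.nat 11 [], ValidState cat R v m n ℓ s q
  mark : ∀ k, s.nat 10 k ≠ 0 ↔ ∃ q < s.nat 11 [], s.key n ℓ q = k
  inj : ∀ q < s.nat 11 [], ∀ q' < s.nat 11 [], s.key n ℓ q = s.key n ℓ q' → q = q'

theorem Queue.congr {s s' : Store} (hq : Queue cat R v m n ℓ s)
    (h11 : s'.nat 11 = s.nat 11) (h10 : s'.nat 10 = s.nat 10)
    (h : ∀ q < s.nat 11 [], SameState s s' q) : Queue cat R v m n ℓ s' := by
  obtain ⟨h1, h2, h3⟩ := hq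
  constructor
  · intro q hq; rw [h11] at hq; exact (h1 q hq).congr (h q hq)
  · intro k; rw [h10, h2, h11]
    refine exists_congr fun q => and_congr_right fun hq => ?_
    rw [(h q hq).key]
  · intro q hq q' hq'
    rw [h11] at hq hq'; rw [(h q hq).key, (h q' hq').key]; exact h3 q hq q' hq'

/-- All states of `s` are states of `s'`. -/
def Extends (s s' : Store) : Prop :=
  s.nat 11 [] ≤ s'.nat 11 [] ∧ ∀ q < s.nat 11 [], SameState s s' q

theorem Extends.trans {s s' s'' : Store} (h : Extends s s') (h' : Extends s' s'') :
    Extends s s'' := by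
  refine ⟨h.1.trans h'.1, fun q hq x => ?_⟩
  obtain ⟨a, b, c⟩ := h.2 q hq x
  obtain ⟨a', b', c'⟩ := h'.2 q (hq.trans_le h.1) x
  exact ⟨a'.trans a, b'.trans b, c'.trans c⟩

/-- Some state has the features `f`. -/
def Present (s : Store) (f : Feature n ℓ → ℕ) : Prop :=
  ∃ q < s.nat 11 [], s.feature q = f

theorem Present.mono {s s' : Store} {f : Feature n ℓ → ℕ} (h : Present s f)
    (h' : Extends s s') : Present s' f := by
  obtain ⟨q, hq, rfl⟩ := h
  exact ⟨q, hq.trans_le h'.1, (h'.2 q hq).feature⟩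

/-- Distinct states have distinct feature vectors, and each vector is a function from the features
to `{0, …, m * k}`. This is the source of the polynomial running time. -/
theorem Queue.size_le {s : Store} {k : ℕ} (hq : Queue cat R v m n ℓ s) (hk : 0 < k)
    (hR : ∀ g < m, ∀ g' < m, R [g, g'] ≤ k) :
    s.nat 11 [] ≤ (m * k + 1) ^ Fintype.card (Feature n ℓ) := by
  have hle : ∀ q < s.nat 11 [], ∀ c : Feature n ℓ, s.feature q c < m * k + 1 := by
    intro q hq' c
    have hv := hq.valid q hq'
    rw [hv.feature_eq]
    exact Nat.lt_succ_of_le (features_le _ _ _ hk hv.guess_lt hv.level_le (hR _ hv.guess_lt) c)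
  have := Fintype.card_le_of_injective
    (fun (q : Fin (s.nat 11 [])) (c : Feature n ℓ) =>
      (⟨s.feature q c, hle q q.2 c⟩ : Fin (m * k + 1))) (by
      intro q q' h
      refine Fin.ext (hq.inj q q.2 q' q'.2 (Store.key_eq_iff.2 ?_))
      funext c
      exact congrArg Fin.val (congrFun h c))
  simpa using this

end states

/-! ### Insertion of a state without duplicates -/

/-- Adds the state in the slot after the last state to the list unless another state has the same
features. -/
noncomputable def pushState (n ℓ : ℕ) : Program :=
  .ite (.natLe (.get 10 fun c : Fin (Fintype.card (Feature n ℓ)) =>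
      .cell₂ 8 (.var 11) (.const c)) (.const 0))
    (.seq (.setNat 10 (fun c : Fin (Fintype.card (Feature n ℓ)) =>
      .cell₂ 8 (.var 11) (.const c)) (.const 1)) (setVar 11 (.add (.var 11) (.const 1)))) .skip

section push

variable {n ℓ m : ℕ} {cat R : List ℕ → ℕ} {v : List ℕ → ℝ}

@[simp] theorem modNat_pushState (a : ℕ) : (pushState n ℓ).ModNat a ↔ a = 10 ∨ a = 11 := by
  simp [pushState]

@[simp] theorem modReal_pushState (a : ℕ) : ¬ (pushState n ℓ).ModReal a := by
  simp [pushState]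

/-- Array `10` is addressed by the feature vector itself, so a duplicate is detected by one memory
access. A duplicate is not erased: as the counter stays, the slot remains outside the list and will
be overwritten. -/
theorem runs_pushState {s : Store} (hq : Queue cat R v m n ℓ s)
    (hs : ValidState cat R v m n ℓ s (s.nat 11 [])) :
    Runs (pushState n ℓ) s 3 fun s' => Queue cat R v m n ℓ s' ∧ Extends s s' ∧
      Present s' (s.feature (s.nat 11 []) : Feature n ℓ → ℕ) := by
  have hkey : (List.ofFn fun c : Fin (Fintype.card (Feature n ℓ)) =>
      (NatExpr.cell₂ 8 (.var 11) (.const c)).eval s) = s.key n ℓ (s.nat 11 []) := by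
    simp [Store.key]
  refine Runs.ite (T := 2) (fun hb => ?_) (fun hb => ?_)
  · rw [Test.holds_natLe, NatExpr.eval_get, hkey, NatExpr.eval_const, Nat.le_zero] at hb
    have hnew : ∀ q < s.nat 11 [], s.key n ℓ q ≠ s.key n ℓ (s.nat 11 []) := by
      intro q hlt h
      exact (hq.mark _).2 ⟨q, hlt, h⟩ hb
    refine Runs.seq (T := 1) (T' := 1) (Runs.setNat (Runs.setVar ?_))
    rw [hkey]
    set s' := ((s.setNat 10 (s.key n ℓ (s.nat 11 [])) ((NatExpr.const 1).eval s)).setNat 11 []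
      (((NatExpr.var 11).add (NatExpr.const 1)).eval
        (s.setNat 10 (s.key n ℓ (s.nat 11 [])) ((NatExpr.const 1).eval s)))) with hs'
    have h11 : s'.nat 11 [] = s.nat 11 [] + 1 := by simp [hs']
    have h10 : ∀ k, s'.nat 10 k = if k = s.key n ℓ (s.nat 11 []) then 1 else s.nat 10 k := by
      intro k; simp [hs']
    have hsame : ∀ q, SameState s s' q := by
      intro q x; simp [hs']
    refine ⟨⟨?_, ?_, ?_⟩, ⟨by omega, fun q _ => hsame q⟩, s.nat 11 [], by omega,
      (hsame _).feature⟩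
    · intro q hlt
      rw [h11] at hlt
      rcases Nat.lt_succ_iff_lt_or_eq.1 hlt with h | rfl
      · exact (hq.valid q h).congr (hsame q)
      · exact hs.congr (hsame _)
    · intro k
      rw [h10, h11]
      simp only [(hsame _).key]
      by_cases hk : k = s.key n ℓ (s.nat 11 [])
      · simp only [hk, if_true]
        exact ⟨fun _ => ⟨_, Nat.lt_succ_self _, rfl⟩, fun _ => one_ne_zero⟩
      · rw [if_neg hk, hq.mark]
        constructor
        · rintro ⟨q, h, h'⟩; exact ⟨q, by omega, h'⟩
        · rintro ⟨q, h, h'⟩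
          rcases Nat.lt_succ_iff_lt_or_eq.1 h with h | rfl
          · exact ⟨q, h, h'⟩
          · exact absurd h'.symm hk
    · intro q h q' h' he
      rw [h11] at h h'
      rw [(hsame q).key, (hsame q').key] at he
      rcases Nat.lt_succ_iff_lt_or_eq.1 h with h | rfl <;>
        rcases Nat.lt_succ_iff_lt_or_eq.1 h' with h' | rfl
      · exact hq.inj q h q' h' he
      · exact absurd he (hnew q h)
      · exact absurd he.symm (hnew q' h')
      · rfl
  · rw [Test.holds_natLe, NatExpr.eval_get, hkey, NatExpr.eval_const, Nat.le_zero] at hb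
    obtain ⟨q, hlt, h⟩ := (hq.mark _).1 hb
    refine (Runs.skip ?_).mono one_le_two (fun _ _ h => h)
    exact ⟨hq, ⟨le_rfl, fun _ _ _ => ⟨rfl, rfl, rfl⟩⟩, q, hlt, Store.key_eq_iff.1 h⟩

end push

/-! ### The initial states, one per guess -/

/-- Adds, for every item, the state in which no item has been allocated. -/
noncomputable def initStates (n ℓ : ℕ) : Program :=
  .seq (setVar 11 (.const 0)) (forVar 13 (.var 0)
    (.seq (unroll fun c : Feature n ℓ => setCell₂ 8 (.var 11) (.const c.code)
      (if c = .inl false then .var 13 else .const 0))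
    (.seq (unroll fun i : Fin n => setRealCell₂ 6 (.var 11) (.const i) (.ofNat (.const 0)))
      (pushState n ℓ))))

section init

variable {n ℓ m : ℕ} {cat R : List ℕ → ℕ} {v : List ℕ → ℝ}

theorem runs_initStates {s : Store} (h0 : s.nat 0 [] = m) (h10 : ∀ k, s.nat 10 k = 0) :
    Runs (initStates n ℓ) s (m * (Fintype.card (Feature n ℓ) + n + 7) + 3) fun s' =>
      Queue cat R v m n ℓ s' ∧
        ∀ g < m, Present s' (features (n := n) (ℓ := ℓ) cat R g 0 fun _ => 0) := by
  refine Runs.mono (T := 1 + (m * (((Fintype.card (Feature n ℓ) * 1 + 1) +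
    ((Fintype.card (Fin n) * 1 + 1) + 3)) + 2) + 2)) ?_
    (by simp only [Fintype.card_fin]; ring_nf; omega) (fun _ _ h => h)
  refine Runs.seq (Runs.setVar (Runs.forVar (B := m) (fun j s' => Queue cat R v m n ℓ s' ∧
        ∀ g < j, Present s' (features (n := n) (ℓ := ℓ) cat R g 0 fun _ => 0)) ?_ ?_ ?_ ?_ ?_))
  · simp
  · rintro j s' c ⟨h1, h2⟩
    have hS : ∀ q, SameState s' (s'.setNat 13 [] c) q := by intro q x; simp
    have e : (s'.setNat 13 [] c).nat 11 = s'.nat 11 := Store.setNat_nat_of_ne _ _ _ (by simp)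
    exact ⟨h1.congr e (Store.setNat_nat_of_ne _ _ _ (by simp)) fun q _ => hS q,
      fun g hg => (h2 g hg).mono ⟨by rw [e], fun q _ => hS q⟩⟩
  · intro s' hf
    rw [NatExpr.eval_var, hf.1 0 (by simp)]; simpa using h0
  · refine ⟨⟨?_, ?_, ?_⟩, by simp⟩ <;> simp [h10]
  · rintro j hj s₁ - hx ⟨hq, hp⟩
    -- The slot being filled has the current number of states as its index, so the existing states
    -- are untouched until `pushState` decides.
    refine Runs.seq ((Runs.unroll (T := 1) (fun D s' =>
      (∀ c ∈ D, s'.feature (s₁.nat 11 []) c = (initFeature j c : ℕ)) ∧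
      ∀ q < s₁.nat 11 [], SameState s₁ s' q) ?_ ?_).mono le_rfl ?_)
    · exact ⟨by simp, fun _ _ _ => ⟨rfl, rfl, rfl⟩⟩
    · rintro c D s' hf ⟨h1, h2⟩
      have e11 : s'.nat 11 = s₁.nat 11 := hf.1 11 (by simp)
      have e13 : s'.nat 13 [] = j := by rw [hf.1 13 (by simp), hx]
      refine Runs.setCell₂ ⟨?_, ?_⟩
      · intro c' hc'
        by_cases h : c' = c
        · subst h
          rcases c' with (_ | _) | ⟨_, _⟩ <;> simp [Store.feature, e11, initFeature, e13]
        · have := h1 c' (by simpa [h] using hc')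
          simpa [Store.feature, e11, h] using this
      · intro q hq' x
        have : q ≠ s₁.nat 11 [] := by omega
        simpa [e11, this] using h2 q hq' x
    · rintro s₂ hf₂ ⟨h1, h2⟩
      have e11 : s₂.nat 11 = s₁.nat 11 := hf₂.1 11 (by simp)
      have e10 : s₂.nat 10 = s₁.nat 10 := hf₂.1 10 (by simp)
      refine Runs.seq ((Runs.unroll (T := 1) (fun (D : Set (Fin n)) s' =>
        (∀ i ∈ D, s'.real 6 [s₁.nat 11 [], (i : ℕ)] = 0) ∧
        ∀ q < s₁.nat 11 [], SameState s₁ s' q) ?_ ?_).mono le_rfl ?_)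
      · exact ⟨by simp, h2⟩
      · rintro i D s' hf ⟨g1, g2⟩
        have e11' : s'.nat 11 = s₁.nat 11 := (hf.1 11 (by simp)).trans e11
        refine Runs.setRealCell₂ ⟨?_, ?_⟩
        · intro i' hi'
          by_cases h : i' = i
          · subst h; simp [e11']
          · have := g1 i' (by simpa [h] using hi')
            simp only [Store.setReal_real, this]; simp
        · intro q hq' x
          have : q ≠ s₁.nat 11 [] := by omega
          simpa [e11', this] using g2 q hq' x
      · rintro s₃ hf₃ ⟨g1, g2⟩
        have f11 : s₃.nat 11 = s₁.nat 11 := (hf₃.1 11 (by simp)).trans e11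
        have f10 : s₃.nat 10 = s₁.nat 10 := (hf₃.1 10 (by simp)).trans e10
        have f8 : s₃.nat 8 = s₂.nat 8 := hf₃.1 8 (by simp)
        have hfeat : (s₃.feature (s₃.nat 11 []) : Feature n ℓ → ℕ) =
            features cat R j 0 fun _ => 0 := by
          funext c
          have := h1 c trivial
          simpa [features, Store.feature, f11, f8] using this
        have hvalid : ValidState cat R v m n ℓ s₃ (s₃.nat 11 []) := by
          refine ⟨?_, ?_, ?_, ?_, ?_⟩
          · rw [hfeat, features_guess]; exact hj
          · rw [hfeat, features_level]; omega
          · rw [hfeat, features_level]; intro g hg; omega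
          · rw [hfeat, features_guess, features_level]
            exact features_congr _ _ _ _ (by simp)
          · rw [hfeat, features_level]; intro i; rw [f11, g1 i trivial]; simp
        refine (runs_pushState (hq.congr f11 f10 g2) hvalid).mono le_rfl ?_
        rintro s₄ - ⟨k1, k2, k3⟩
        refine ⟨k1, fun g hg => ?_⟩
        by_cases hgj : g = j
        · subst hgj; rwa [hfeat] at k3
        · exact (hp g (by omega)).mono (Extends.trans ⟨by rw [f11], g2⟩ k2)

end init

end QuotaMMS

namespace QuotaMMS

open Program

/-! ### The transitions -/

noncomputable def guessExpr (n ℓ : ℕ) : NatExpr :=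
  .cell₂ 8 (.var 12) (.const (Feature.code (.inl false : Feature n ℓ)))

noncomputable def levelExpr (n ℓ : ℕ) : NatExpr :=
  .cell₂ 8 (.var 12) (.const (Feature.code (.inl true : Feature n ℓ)))

/-- The increment of a feature when agent `i` receives the next item of the state in cell `12`. -/
noncomputable def stepExpr {n ℓ : ℕ} (i : Fin n) : Feature n ℓ → NatExpr
  | .inl false => .const 0
  | .inl true => .const 1
  | .inr (i', some j) =>
    if i' = i then
      -- With truncated subtraction, `1 - ((c - j) + (j - c))` is the indicator of `c = j`.
      .sub (.const 1) (.add (.sub (.cell 1 (levelExpr n ℓ)) (.const j))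
        (.sub (.const j) (.cell 1 (levelExpr n ℓ))))
    else .const 0
  | .inr (i', none) => if i' = i then .cell₂ 7 (guessExpr n ℓ) (levelExpr n ℓ) else .const 0

/-- Writes the successor of the state in cell `12` in which agent `i` receives the next item to the
slot after the last state. -/
noncomputable def writeSucc {n : ℕ} (ℓ : ℕ) (i : Fin n) : Program :=
  .seq (unroll fun c : Feature n ℓ => setCell₂ 8 (.var 11) (.const c.code)
    (.add (.cell₂ 8 (.var 12) (.const c.code)) (stepExpr i c)))
  (.seq (unroll fun i' : Fin n => setRealCell₂ 6 (.var 11) (.const i')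
    (.add (.cell₂ 6 (.var 12) (.const i'))
      (if i' = i then .cell₂ 1 (.const 0) (levelExpr n ℓ) else .ofNat (.const 0))))
  (.seq (forVar 13 (levelExpr n ℓ) (setCell₂ 9 (.var 11) (.var 13) (.cell₂ 9 (.var 12) (.var 13))))
    (setCell₂ 9 (.var 11) (levelExpr n ℓ) (.const i))))

/-- Adds the successors of all states. -/
noncomputable def expandStates (n ℓ : ℕ) : Program :=
  .seq (setVar 12 (.const 0)) (.loop (.natLt (.var 12) (.var 11))
    (.seq (.ite (.natLt (levelExpr n ℓ) (.var 0))
      (unroll fun i : Fin n => .seq (writeSucc ℓ i) (pushState n ℓ)) .skip)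
      (setVar 12 (.add (.var 12) (.const 1)))))

variable {n ℓ m : ℕ} {cat R : List ℕ → ℕ} {v : List ℕ → ℝ}

@[simp] theorem eval_guessExpr (s : Store) :
    (guessExpr n ℓ).eval s = s.feature (s.nat 12 []) (.inl false : Feature n ℓ) := by
  simp [guessExpr, Store.feature]

@[simp] theorem eval_levelExpr (s : Store) :
    (levelExpr n ℓ).eval s = s.feature (s.nat 12 []) (.inl true : Feature n ℓ) := by
  simp [levelExpr, Store.feature]

theorem eval_stepExpr (s : Store) (i : Fin n) (c : Feature n ℓ) :
    (stepExpr i c).eval s = featureStep (s.nat 1) (s.nat 7)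
      (s.feature (s.nat 12 []) (.inl false : Feature n ℓ))
      (s.feature (s.nat 12 []) (.inl true : Feature n ℓ)) i c := by
  match c with
  | .inl false => simp [stepExpr, featureStep]
  | .inl true => simp [stepExpr, featureStep]
  | .inr (i', some j) =>
    by_cases h : i' = i
    · simp only [stepExpr, featureStep, h, if_true, true_and, NatExpr.eval_sub, NatExpr.eval_const,
        NatExpr.eval_add, NatExpr.eval_cell, eval_levelExpr]
      split_ifs <;> omega
    · simp [stepExpr, featureStep, h, Fin.val_inj]
  | .inr (i', none) =>
    by_cases h : i' = i <;> simp [stepExpr, featureStep, h, Fin.val_inj]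

@[simp] theorem modNat_writeSucc (i : Fin n) (a : ℕ) :
    (writeSucc ℓ i).ModNat a ↔ a = 8 ∨ a = 13 ∨ a = 9 := by
  simp [writeSucc]

@[simp] theorem modReal_writeSucc (i : Fin n) (a : ℕ) :
    (writeSucc ℓ i).ModReal a ↔ a = 6 := by
  simp only [writeSucc, modReal_seq, modReal_unroll, modReal_setCell₂, modReal_setRealCell₂,
    modReal_forVar, exists_const, or_false, false_or]
  exact ⟨fun ⟨_, h⟩ => h, fun h => ⟨i, h⟩⟩

/-- The slot `z` lies behind the list while the parent `p` lies in it, so every write preserves the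
parent from which the later reads are made. The real bundle values are exact; only the features are
rounded. -/
theorem runs_writeSucc {s : Store} (i : Fin n) (hq : Queue cat R v m n ℓ s)
    (hcat : s.nat 1 = cat) (hR : s.nat 7 = R) (hv : s.real 1 = v)
    (hp : s.nat 12 [] < s.nat 11 []) (hL : s.feature (s.nat 12 []) (.inl true : Feature n ℓ) < m) :
    Runs (writeSucc ℓ i) s (Fintype.card (Feature n ℓ) + n + m * 3 + 5) fun s' =>
      ValidState cat R v m n ℓ s' (s'.nat 11 []) ∧
      (s'.feature (s'.nat 11 []) : Feature n ℓ → ℕ) =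
        succFeature cat R (s.feature (s.nat 12 [])) i ∧
      ∀ q < s.nat 11 [], SameState s s' q := by
  set p := s.nat 12 [] with hp_def
  set z := s.nat 11 [] with hz
  set L := s.feature p (.inl true : Feature n ℓ) with hL_def
  refine Runs.mono (T := (Fintype.card (Feature n ℓ) * 1 + 1) + ((Fintype.card (Fin n) * 1 + 1) +
    ((L * (1 + 2) + 2) + 1))) ?_ (by simp only [Fintype.card_fin]; omega) (fun _ _ h => h)
  -- The parent is one of the preserved states, so its features can be read off the original store
  -- at every stage.
  have keep : ∀ s', (∀ q < z, SameState s s' q) →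
      (s'.feature p : Feature n ℓ → ℕ) = s.feature p := fun s' h => (h p hp).feature
  refine Runs.seq ((Runs.unroll (T := 1) (fun D s' =>
      (∀ c ∈ D, s'.feature z c = succFeature cat R (s.feature p) i c) ∧
      ∀ q < z, SameState s s' q) ?_ ?_).mono le_rfl ?_)
  · exact ⟨by simp, fun _ _ _ => ⟨rfl, rfl, rfl⟩⟩
  · rintro c D s' hf ⟨h1, h2⟩
    have e11 : s'.nat 11 = s.nat 11 := hf.1 11 (by simp)
    have e12 : s'.nat 12 = s.nat 12 := hf.1 12 (by simp)
    have e1 : s'.nat 1 = cat := by rw [hf.1 1 (by simp), hcat]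
    have e7 : s'.nat 7 = R := by rw [hf.1 7 (by simp), hR]
    have hval : (NatExpr.add (.cell₂ 8 (.var 12) (.const c.code)) (stepExpr i c)).eval s' =
        succFeature cat R (s.feature p) i c := by
      rw [NatExpr.eval_add, eval_stepExpr, e12, ← hp_def, e1, e7, keep s' h2]
      have := congrFun (keep s' h2) c
      simp only [Store.feature] at this
      simp [e12, ← hp_def, succFeature, this, Store.feature]
    refine Runs.setCell₂ ?_
    rw [hval, NatExpr.eval_var, e11, ← hz, NatExpr.eval_const]
    refine ⟨?_, ?_⟩
    · intro c' hc'
      by_cases h : c' = c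
      · subst h; simp [Store.feature]
      · have := h1 c' (by simpa [h] using hc')
        simpa [Store.feature, h] using this
    · intro q hq' x
      have : q ≠ z := by omega
      simpa [this] using h2 q hq' x
  · rintro s₁ hf₁ ⟨h1, h2⟩
    refine Runs.seq ((Runs.unroll (T := 1) (fun (D : Set (Fin n)) s' =>
      (∀ i' ∈ D, s'.real 6 [z, (i' : ℕ)] = s.real 6 [p, (i' : ℕ)] + if i' = i then v [0, L] else 0) ∧
      ∀ q < z, SameState s s' q) ?_ ?_).mono le_rfl ?_)
    · exact ⟨by simp, h2⟩
    · rintro i' D s' hf ⟨g1, g2⟩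
      have e11 : s'.nat 11 = s.nat 11 := (hf.1 11 (by simp)).trans (hf₁.1 11 (by simp))
      have e12 : s'.nat 12 = s.nat 12 := (hf.1 12 (by simp)).trans (hf₁.1 12 (by simp))
      have e1 : s'.real 1 = v := ((hf.2 1 (by simp)).trans (hf₁.2 1 (by simp))).trans hv
      refine Runs.setRealCell₂ ?_
      have hval : (RealExpr.add (.cell₂ 6 (.var 12) (.const i')) (if i' = i then
          .cell₂ 1 (.const 0) (levelExpr n ℓ) else .ofNat (.const 0))).eval s' =
          s.real 6 [p, (i' : ℕ)] + if i' = i then v [0, L] else 0 := by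
        have h6 := (g2 p hp i').2.2
        split_ifs <;> simp [e12, ← hp_def, h6, e1, keep s' g2, ← hL_def]
      rw [hval, NatExpr.eval_var, e11, ← hz, NatExpr.eval_const]
      refine ⟨?_, ?_⟩
      · intro i'' hi''
        by_cases h : i'' = i'
        · subst h; simp
        · have := g1 i'' (by simpa [h] using hi'')
          rw [← this]; simp [h, Fin.val_inj]
      · intro q hq' x
        have : q ≠ z := by omega
        simpa [this] using g2 q hq' x
    · rintro s₂ hf₂ ⟨g1, g2⟩
      have a11 : s₂.nat 11 = s.nat 11 := (hf₂.1 11 (by simp)).trans (hf₁.1 11 (by simp))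
      have a12 : s₂.nat 12 = s.nat 12 := (hf₂.1 12 (by simp)).trans (hf₁.1 12 (by simp))
      have a8 : s₂.nat 8 = s₁.nat 8 := hf₂.1 8 (by simp)
      refine Runs.seq ((Runs.forVar (B := L) (T := 1) (fun j s' =>
        (∀ g < j, s'.nat 9 [z, g] = s.nat 9 [p, g]) ∧ ∀ q < z, SameState s s' q) (by simp)
        ?_ ?_ ⟨by simp, g2⟩ ?_).mono le_rfl ?_)
      · intro j s' c h; simpa [SameState] using h
      · intro s' hf
        rw [eval_levelExpr, hf.1 12 (by simp), a12, ← hp_def]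
        have : (s'.feature p : Feature n ℓ → ℕ) = s.feature p := by
          rw [← keep s₂ g2]; funext c
          show s'.nat 8 _ = s₂.nat 8 _
          rw [hf.1 8 (by simp)]
        rw [this]
      · rintro j hj s' hf hx ⟨k1, k2⟩
        have e11 : s'.nat 11 = s.nat 11 := (hf.1 11 (by simp)).trans a11
        have e12 : s'.nat 12 = s.nat 12 := (hf.1 12 (by simp)).trans a12
        refine Runs.setCell₂ ?_
        simp only [NatExpr.eval_var, NatExpr.eval_cell₂, e11, e12, hx, ← hz, ← hp_def,
          (k2 p hp j).2.1]
        refine ⟨?_, ?_⟩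
        · intro g hg
          by_cases h : g = j
          · subst h; simp
          · simpa [h] using k1 g (by omega)
        · intro q hq' x
          have : q ≠ z := by omega
          simpa [this] using k2 q hq' x
      · rintro s₃ hf₃ ⟨k1, k2⟩
        have b11 : s₃.nat 11 = s.nat 11 := (hf₃.1 11 (by simp)).trans a11
        have b12 : s₃.nat 12 = s.nat 12 := (hf₃.1 12 (by simp)).trans a12
        have b8 : s₃.nat 8 = s₁.nat 8 := (hf₃.1 8 (by simp)).trans a8
        have b6 : s₃.real 6 = s₂.real 6 := hf₃.2 6 (by simp)
        refine Runs.setCell₂ ?_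
        simp only [NatExpr.eval_var, eval_levelExpr, NatExpr.eval_const, b11, b12, ← hz, ← hp_def,
          keep s₃ k2, ← hL_def]
        set s₄ := s₃.setNat 9 [z, L] i with hs₄
        have c11 : s₄.nat 11 [] = z := by simp [hs₄, b11, hz]
        have c6 : s₄.real 6 = s₂.real 6 := b6
        have c9 : ∀ g, s₄.nat 9 [z, g] = if g = L then (i : ℕ) else s₃.nat 9 [z, g] := by
          intro g; simp [hs₄]
        have hfeat : (s₄.feature z : Feature n ℓ → ℕ) = succFeature cat R (s.feature p) i := by
          funext c
          rw [← h1 c trivial]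
          simp [Store.feature, hs₄, b8]
        have hguess : s₄.feature z (.inl false : Feature n ℓ) =
            s.feature p (.inl false : Feature n ℓ) := by
          rw [hfeat]; simp [succFeature, featureStep]
        have hlevel : s₄.feature z (.inl true : Feature n ℓ) = L + 1 := by
          rw [hfeat]; simp [succFeature, featureStep, hL_def]
        have hvp := hq.valid p hp
        have c9' : ∀ g < L, s₄.nat 9 [z, g] = s.nat 9 [p, g] := by
          intro g hg
          rw [c9, if_neg hg.ne, k1 g hg]
        have c9L : s₄.nat 9 [z, L] = i := by simp [c9]
        refine ⟨?_, by rw [c11]; exact hfeat, ?_⟩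
        · rw [c11]
          refine ⟨?_, ?_, ?_, ?_, ?_⟩
          · rw [hguess]; exact hvp.guess_lt
          · rw [hlevel]; exact hL
          · rw [hlevel]; intro g hg
            rcases Nat.lt_succ_iff_lt_or_eq.1 hg with h | rfl
            · rw [c9' g h]; exact hvp.agent_lt g h
            · rw [c9L]; exact i.2
          · rw [hguess, hlevel, features_succ, hfeat, c9L]
            congr 1
            -- The successor has the parent's allocation on the first `L` items, so its features are
            -- the successor of the parent's features.
            rw [hvp.feature_eq]
            simp only [features_guess]
            exact features_congr _ _ _ _ fun g hg => (c9' g hg).symm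
          · intro i'
            rw [hlevel, Finset.sum_range_succ, c9L, c6, g1 i' trivial, hvp.value_eq]
            congr 1
            · exact Finset.sum_congr rfl fun g hg => by rw [c9' g (Finset.mem_range.1 hg)]
            · simp [Fin.val_inj, eq_comm]
        · intro q hq' x
          have : q ≠ z := by omega
          simpa [hs₄, this] using k2 q hq' x

/-- The successors of the first `p` states are states. -/
def Closed (cat R : List ℕ → ℕ) (m n ℓ : ℕ) (s : Store) (p : ℕ) : Prop :=
  ∀ q < p, s.feature q (.inl true : Feature n ℓ) < m → ∀ i : Fin n,
    Present s (succFeature cat R (s.feature q : Feature n ℓ → ℕ) i)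

/-- The list is a work queue: new states are appended while cell `12` advances, and the loop ends
when it has passed all of them. Closedness up to the pointer thus becomes closedness of the whole
list, and `Queue.size_le` bounds the number of rounds. -/
theorem runs_expandStates {s : Store} {k : ℕ} (hq : Queue cat R v m n ℓ s)
    (h0 : s.nat 0 [] = m) (hcat : s.nat 1 = cat) (hR : s.nat 7 = R) (hv : s.real 1 = v)
    (hk : 0 < k) (hle : ∀ g < m, ∀ g' < m, R [g, g'] ≤ k) :
    Runs (expandStates n ℓ) s ((m * k + 1) ^ Fintype.card (Feature n ℓ) *
        (n * (Fintype.card (Feature n ℓ) + n + m * 3 + 8) + 4) + 2) fun s' =>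
      Queue cat R v m n ℓ s' ∧ Extends s s' ∧ Closed cat R m n ℓ s' (s'.nat 11 []) := by
  set K := Fintype.card (Feature n ℓ) with hK
  set S := (m * k + 1) ^ K with hS
  refine Runs.mono (T := 1 + (S * ((((Fintype.card (Fin n) * ((K + n + m * 3 + 5) + 3) + 1) + 1) +
    1) + 1) + 1)) ?_ (by simp only [Fintype.card_fin]; ring_nf; omega) (fun _ _ h => h)
  refine Runs.seq (Runs.setVar ((Runs.loop (Inv := fun s' => Queue cat R v m n ℓ s' ∧
    Extends s s' ∧ Closed cat R m n ℓ s' (s'.nat 12 []) ∧ s'.nat 12 [] ≤ s'.nat 11 [])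
    (fun s' => S - s'.nat 12 []) (T := ((Fintype.card (Fin n) * ((K + n + m * 3 + 5) + 3) + 1) + 1)
    + 1) ?_ (F := S) (by simp) ?_).mono le_rfl ?_))
  · rintro s₁ hf ⟨i1, i2, i3, i4⟩ hb
    simp only [Test.holds_natLt, NatExpr.eval_var] at hb
    have e0 : s₁.nat 0 [] = m := by rw [hf.1 0 (by simp)]; simpa using h0
    have e1 : s₁.nat 1 = cat := by
      rw [hf.1 1 (by simp), Store.setNat_nat_of_ne _ _ _ (by simp), hcat]
    have e7 : s₁.nat 7 = R := by
      rw [hf.1 7 (by simp), Store.setNat_nat_of_ne _ _ _ (by simp), hR]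
    have e1' : s₁.real 1 = v := by rw [hf.2 1 (by simp)]; exact hv
    set p := s₁.nat 12 [] with hp
    -- The end of a round, shared by complete states, which need no successors, and incomplete ones.
    have final : ∀ s', s'.nat 12 [] = p → Queue cat R v m n ℓ s' → Extends s₁ s' →
        (s₁.feature p (.inl true : Feature n ℓ) < m → ∀ i : Fin n,
          Present s' (succFeature cat R (s₁.feature p : Feature n ℓ → ℕ) i)) →
        Runs (setVar 12 (.add (.var 12) (.const 1))) s' 1 fun s' => (Queue cat R v m n ℓ s' ∧
          Extends s s' ∧ Closed cat R m n ℓ s' (s'.nat 12 []) ∧ s'.nat 12 [] ≤ s'.nat 11 []) ∧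
          S - s'.nat 12 [] < S - p := by
      intro s' h12 hq' hext hpres
      refine Runs.setVar ?_
      set s'' := s'.setNat 12 [] ((NatExpr.add (.var 12) (.const 1)).eval s') with hs''
      have f12 : s''.nat 12 [] = p + 1 := by simp [hs'', h12]
      have f11 : s''.nat 11 = s'.nat 11 := Store.setNat_nat_of_ne _ _ _ (by simp)
      have hsame : ∀ q, SameState s' s'' q := by intro q x; simp [hs'']
      have hext' : Extends s' s'' := ⟨by rw [f11], fun q _ => hsame q⟩
      have hb' := hext.1
      -- The size bound also holds for the enlarged list, so the pointer is below `S` and the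
      -- measure decreases.
      have hsz : s'.nat 11 [] ≤ S := hq'.size_le hk hle
      rw [f12, f11]
      refine ⟨⟨hq'.congr f11 (Store.setNat_nat_of_ne _ _ _ (by simp)) fun q _ => hsame q,
        i2.trans (hext.trans hext'), ?_, by omega⟩, by omega⟩
      intro q hqp hlt i
      have hfeat : (s''.feature q : Feature n ℓ → ℕ) = s₁.feature q :=
        (hsame q).feature.trans (hext.2 q (by omega)).feature
      rw [hfeat] at hlt ⊢
      rcases Nat.lt_succ_iff_lt_or_eq.1 hqp with h | h
      · exact (i3 q h hlt i).mono (hext.trans hext')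
      · subst h
        exact (hpres hlt i).mono hext'
    refine Runs.seq (Runs.ite (fun hb' => ?_) (fun hb' => ?_))
    · simp only [Test.holds_natLt, eval_levelExpr, NatExpr.eval_var, e0] at hb'
      refine (Runs.unroll (T := (K + n + m * 3 + 5) + 3) (fun (D : Set (Fin n)) s' =>
        Queue cat R v m n ℓ s' ∧ Extends s₁ s' ∧ ∀ i ∈ D,
          Present s' (succFeature cat R (s₁.feature p : Feature n ℓ → ℕ) i))
        ⟨i1, ⟨le_rfl, fun _ _ _ => ⟨rfl, rfl, rfl⟩⟩, by simp⟩ ?_).mono le_rfl ?_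
      · rintro i D s₂ hf₂ ⟨j1, j2, j3⟩
        have g12 : s₂.nat 12 = s₁.nat 12 := hf₂.1 12 (by simp)
        have g1 : s₂.nat 1 = cat := (hf₂.1 1 (by simp)).trans e1
        have g7 : s₂.nat 7 = R := (hf₂.1 7 (by simp)).trans e7
        have g1' : s₂.real 1 = v := (hf₂.2 1 (by simp)).trans e1'
        have hfeat : (s₂.feature p : Feature n ℓ → ℕ) = s₁.feature p := (j2.2 p hb).feature
        refine Runs.seq ((runs_writeSucc i j1 g1 g7 g1'
          (by rw [g12]; exact hb.trans_le j2.1) (by rw [g12, hfeat]; exact hb')).mono le_rfl ?_)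
        rintro s₃ hf₃ ⟨k1, k2, k3⟩
        rw [g12, ← hp, hfeat] at k2
        have r11 : s₃.nat 11 = s₂.nat 11 := hf₃.1 11 (by simp)
        refine (runs_pushState (j1.congr r11 (hf₃.1 10 (by simp)) k3) k1).mono le_rfl ?_
        rintro s₄ - ⟨l1, l2, l3⟩
        have hext : Extends s₂ s₄ := Extends.trans ⟨by rw [r11], k3⟩ l2
        refine ⟨l1, j2.trans hext, ?_⟩
        intro i' hi'
        by_cases h : i' = i
        · subst h; rwa [k2] at l3
        · exact (j3 i' (by simpa [h] using hi')).mono hext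
      · rintro s' hf' ⟨j1, j2, j3⟩
        exact final s' (by rw [hf'.1 12 (by simp)]) j1 j2 fun _ i => j3 i trivial
    · simp only [Test.holds_natLt, eval_levelExpr, NatExpr.eval_var, e0] at hb'
      exact (Runs.skip (final s₁ rfl i1 ⟨le_rfl, fun _ _ _ => ⟨rfl, rfl, rfl⟩⟩
        fun h => absurd h hb')).mono (by omega) (fun _ _ h => h)
  · set s' := s.setNat 12 [] ((NatExpr.const 0).eval s) with hs'
    have f11 : s'.nat 11 = s.nat 11 := Store.setNat_nat_of_ne _ _ _ (by simp)
    have f12 : s'.nat 12 [] = 0 := by simp [hs']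
    have hsame : ∀ q, SameState s s' q := by intro q x; simp [hs']
    refine ⟨hq.congr f11 (Store.setNat_nat_of_ne _ _ _ (by simp)) fun q _ => hsame q,
      ⟨by rw [f11], fun q _ => hsame q⟩, ?_, by rw [f12]; omega⟩
    rw [f12]; intro q hq; omega
  · rintro s' - ⟨⟨i1, i2, i3, i4⟩, hb⟩
    simp only [Test.holds_natLt, NatExpr.eval_var, not_lt] at hb
    refine ⟨i1, i2, ?_⟩
    rwa [← le_antisymm i4 hb]

/-- If the set of states contains the initial states and is closed, it contains a state for every
allocation of the first items. -/
theorem present_features {s : Store} (hinit : ∀ g < m, Present s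
      (features (n := n) (ℓ := ℓ) cat R g 0 fun _ => 0))
    (hclosed : Closed cat R m n ℓ s (s.nat 11 [])) {g₀ : ℕ} (hg₀ : g₀ < m) {a : ℕ → ℕ}
    (ha : ∀ g < m, a g < n) :
    ∀ L ≤ m, Present s (features (n := n) (ℓ := ℓ) cat R g₀ L a) := by
  intro L
  induction L with
  | zero =>
    intro _
    rw [features_congr (b := fun _ => 0) _ _ _ _ (by simp)]
    exact hinit g₀ hg₀
  | succ L ih =>
    intro hL
    obtain ⟨q, hq, hfeat⟩ := ih (by omega)
    have := hclosed q hq (by rw [hfeat, features_level]; omega) ⟨a L, ha L (by omega)⟩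
    rwa [hfeat, ← features_succ] at this

end QuotaMMS

namespace QuotaMMS

open Program

variable {n ℓ m : ℕ} {cat R : List ℕ → ℕ} {v : List ℕ → ℝ}

/-! ### Selection of a state and output -/

/-- The allocation of the state `q` is complete and feasible. -/
def Store.Good (n ℓ : ℕ) (s : Store) (q : ℕ) : Prop :=
  s.nat 0 [] ≤ s.feature q (.inl true : Feature n ℓ) ∧ ∀ (i : Fin n) (j : Fin ℓ),
    s.nat 2 [(j : ℕ)] ≤ s.feature q (.inr (i, some j)) ∧
      s.feature q (.inr (i, some j)) ≤ s.nat 3 [(j : ℕ)]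

noncomputable def goodTest (n ℓ : ℕ) (x : NatExpr) : Test :=
  .and (.natLe (.var 0) (.cell₂ 8 x (.const (Feature.code (.inl true : Feature n ℓ)))))
    (.all fun i : Fin n => .all fun j : Fin ℓ => .and
      (.natLe (.cell 2 (.const j)) (.cell₂ 8 x (.const (Feature.code (.inr (i, some j))))))
      (.natLe (.cell₂ 8 x (.const (Feature.code (.inr (i, some j))))) (.cell 3 (.const j))))

@[simp] theorem holds_goodTest (s : Store) (x : NatExpr) :
    (goodTest n ℓ x).holds s ↔ s.Good n ℓ (x.eval s) := by
  simp [goodTest, Store.Good, Store.feature]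

/-- Minima are compared without being computed: the minimum of the current state is at most that of
the candidate iff every bundle of the candidate dominates some bundle of the current state. Cell
`17` starts at state `0`, which may fail `goodTest`; in that case any good candidate replaces it. -/
noncomputable def selectState (n ℓ : ℕ) : Program :=
  .seq (setVar 17 (.const 0)) (forVar 13 (.var 11)
    (.ite (.and (goodTest n ℓ (.var 13)) (.or (.not (goodTest n ℓ (.var 17)))
      (.all fun i : Fin n => .any fun i' : Fin n =>
        .realLe (.cell₂ 6 (.var 17) (.const i')) (.cell₂ 6 (.var 13) (.const i)))))
      (setVar 17 (.var 13)) .skip))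

theorem runs_selectState (s : Store) :
    Runs (selectState n ℓ) s (s.nat 11 [] * 4 + 3) fun s' => ∀ q < s.nat 11 [], s.Good n ℓ q →
      s'.nat 17 [] < s.nat 11 [] ∧ s.Good n ℓ (s'.nat 17 []) ∧
        ∀ i : Fin n, ∃ i' : Fin n, s.real 6 [q, (i' : ℕ)] ≤ s.real 6 [s'.nat 17 [], (i : ℕ)] := by
  refine Runs.mono (T := 1 + (s.nat 11 [] * (2 + 2) + 2)) ?_ (by omega) (fun _ _ h => h)
  refine Runs.seq (Runs.setVar ((Runs.forVar (B := s.nat 11 []) (fun j s' =>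
    -- The alternative `= 0` covers the default choice before any state has been inspected.
    (s'.nat 17 [] = 0 ∨ s'.nat 17 [] < j) ∧ ∀ q < j, s.Good n ℓ q → s.Good n ℓ (s'.nat 17 []) ∧
        ∀ i : Fin n, ∃ i' : Fin n, s.real 6 [q, (i' : ℕ)] ≤ s.real 6 [s'.nat 17 [], (i : ℕ)])
    (by simp) ?_ ?_ (by simp) ?_).mono le_rfl ?_))
  · intro j s' c h; simpa using h
  · intro s' hf; simp [hf.1 11 (by simp)]
  · rintro j hj s' hf hx ⟨hb, hi⟩
    have hG : ∀ q, s'.Good n ℓ q ↔ s.Good n ℓ q := by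
      intro q
      unfold Store.Good Store.feature
      rw [hf.1 0 (by simp), hf.1 2 (by simp), hf.1 3 (by simp), hf.1 8 (by simp)]
      simp
    have h6 : s'.real 6 = s.real 6 := hf.2 6 (by simp)
    refine Runs.ite (T := 1) (fun h => Runs.setVar ?_) (fun h => Runs.skip ?_) <;>
      simp only [Test.holds_and, holds_goodTest, NatExpr.eval_var, hx, hG, Test.holds_or,
        Test.holds_not, Test.holds_all, Test.holds_any, Test.holds_realLe, RealExpr.eval_cell₂, h6,
        NatExpr.eval_const] at h
    · simp only [NatExpr.eval_var, hx, Store.setNat_nat, and_self, if_true]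
      refine ⟨Or.inr (Nat.lt_succ_self j), fun q hq hqg => ⟨h.1, fun i => ?_⟩⟩
      rcases Nat.lt_succ_iff_lt_or_eq.1 hq with hq | rfl
      · obtain ⟨g1, g2⟩ := hi q hq hqg
        obtain ⟨i', hi'⟩ := (h.2.resolve_left (not_not.2 g1)) i
        obtain ⟨i'', hi''⟩ := g2 i'
        exact ⟨i'', hi''.trans hi'⟩
      · exact ⟨i, le_rfl⟩
    · refine ⟨hb.imp id fun h => by omega, fun q hq hqg => ?_⟩
      rcases Nat.lt_succ_iff_lt_or_eq.1 hq with hq | rfl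
      · exact hi q hq hqg
      · push Not at h
        obtain ⟨g1, i', h'⟩ := h hqg
        exact ⟨g1, fun i => ⟨i', (h' i).le⟩⟩
  · rintro s' - ⟨hb, hi⟩ q hq hg
    exact ⟨by omega, hi q hq hg⟩

def outputState : Program := forVar 13 (.var 0) (setCell 4 (.var 13) (.cell₂ 9 (.var 17) (.var 13)))

theorem runs_outputState (s : Store) :
    Runs outputState s (s.nat 0 [] * 3 + 2) fun s' =>
      ∀ g < s.nat 0 [], s'.nat 4 [g] = s.nat 9 [s.nat 17 [], g] := by
  refine Runs.forVar (B := s.nat 0 []) (T := 1)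
    (fun j s' => ∀ g < j, s'.nat 4 [g] = s.nat 9 [s.nat 17 [], g]) (by simp) ?_ ?_ (by simp) ?_
  · intro j s' c h; simpa using h
  · intro s' hf; simp [hf.1 0 (by simp)]
  · intro j hj s' hf hx hi
    refine Runs.setCell ?_
    intro g hg
    by_cases h : g = j
    · simp [h, hx, hf.1 9 (by simp), hf.1 17 (by simp)]
    · simp [h, hx, hi g (by omega)]

/-! ### The whole program -/

/-- Computes approximate maximin share allocations for identical agents, both for goods and for
chores. -/
noncomputable def mmsProgram (n ℓ : ℕ) : Program :=
  .seq scale (.seq absValues (.seq roundValues (.seq (initStates n ℓ) (.seq (expandStates n ℓ)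
    (.seq (selectState n ℓ) outputState)))))

/-- A bound for the number of steps of `mmsProgram`. -/
noncomputable def mmsTime {A : Type*} [CommSemiring A] (n ℓ : ℕ) (m N : A) : A :=
  let K := Fintype.card (Feature n ℓ)
  let c := m * N + 1
  N * 4 + 4 + (m * 4 + 2 + (m * (m * (N * 3 + c * 3 + 9) + 4) + 2 +
    (m * (K + n + 7) + 3 + ((m * c + 1) ^ K * (n * (K + n + m * 3 + 8) + 4) + 2 +
      ((m * c + 1) ^ K * 4 + 3 + (m * 3 + 2))))))

/-- What is known about the final store. -/
structure FinalStore {m : ℕ} (I : Instance n m ℓ) (ε : ℝ) (s : Store) : Prop where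
  exists_precision : ∃ N : ℕ, (m : ℝ) ≤ N * ε ∧ ∀ g < m, ∀ g' < m,
    IsRound N (m * N + 1) |(inputStore I ε).real 1 [0, g]| |(inputStore I ε).real 1 [0, g']|
      (s.nat 7 [g, g'])
  queue : Queue ((inputStore I ε).nat 1) (s.nat 7) ((inputStore I ε).real 1) m n ℓ s
  init : ∀ g < m, Present s
    (features (n := n) (ℓ := ℓ) ((inputStore I ε).nat 1) (s.nat 7) g 0 fun _ => 0)
  closed : Closed ((inputStore I ε).nat 1) (s.nat 7) m n ℓ s (s.nat 11 [])
  input : ∀ a < 4, s.nat a = (inputStore I ε).nat a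
  best : ∀ q < s.nat 11 [], s.Good n ℓ q → s.nat 17 [] < s.nat 11 [] ∧ s.Good n ℓ (s.nat 17 []) ∧
    ∀ i : Fin n, ∃ i' : Fin n, s.real 6 [q, (i' : ℕ)] ≤ s.real 6 [s.nat 17 [], (i : ℕ)]
  output : ∀ g < m, s.nat 4 [g] = s.nat 9 [s.nat 17 [], g]

end QuotaMMS

namespace QuotaMMS

/-! ## The approximation guarantee -/

section guarantee

variable {n m ℓ : ℕ} {I : Instance n m ℓ}

/-- Besides an optimal allocation, this supplies a bundle worth exactly the maximin share, in which
the guess for goods is taken. -/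
theorem Instance.exists_feasible_mms (I : Instance n m ℓ) (i : Fin n) :
    ∃ P, I.Feasible P ∧ (∀ k, I.mms i ≤ I.valuation i (Allocation.bundle P k)) ∧
      ∃ k, I.valuation i (Allocation.bundle P k) = I.mms i := by
  obtain ⟨P, hP, h⟩ := (I.isGreatest_mms i).1
  have : Nonempty (Fin n) := ⟨i⟩
  refine ⟨P, hP, fun k => ?_, ?_⟩
  · rw [h]; exact ciInf_le (Set.finite_range _).bddBelow k
  · obtain ⟨k, hk⟩ := exists_eq_ciInf_of_finite (f := fun k => I.valuation i (P.bundle k))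
    exact ⟨k, by rw [h, ← hk]⟩

variable {ε : ℝ} {N : ℕ} {r : Fin m → Fin m → ℕ} {i : Fin n} {A : Allocation n m}

/-- The guarantee for goods of an allocation `A` whose least valuable bundle is at least as good as
that of some allocation with the same rounded values as `P`, for every feasible allocation `P` and
every item in terms of which the values are rounded. -/
theorem goods_guarantee (hI : I.IsGoods) (hm : 0 < m) (hN : (m : ℝ) ≤ N * ε)
    (hr : ∀ g g', IsRound N (m * N + 1) |I.value i g| |I.value i g'| (r g g'))
    (hA : ∀ g P, I.Feasible P → ∃ A' : Allocation n m,
      (∀ k, ∑ g' ∈ A'.bundle k, r g g' = ∑ g' ∈ Allocation.bundle P k, r g g') ∧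
      ∀ k, ∃ k', I.valuation i (A'.bundle k') ≤ I.valuation i (A.bundle k)) (k : Fin n) :
    (1 - ε) * I.mms i ≤ I.valuation i (A.bundle k) := by
  obtain ⟨P, hP, hle, k₀, hk₀⟩ := I.exists_feasible_mms i
  have hnn : ∀ S, 0 ≤ I.valuation i S := fun S => Finset.sum_nonneg fun g _ => hI i g
  set μ := I.mms i with hμ
  rcases (hk₀ ▸ hnn _ : 0 ≤ μ).eq_or_lt with h0 | hpos
  · rw [← h0, mul_zero]; exact hnn _
  have hne : (Allocation.bundle P k₀).Nonempty := by
    rw [Finset.nonempty_iff_ne_empty]; intro h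
    rw [h] at hk₀; simp [Instance.valuation] at hk₀; exact hpos.ne hk₀
  -- The right guess: the most valuable item of a bundle worth exactly `μ`. It satisfies `B ≤ μ`,
  -- which makes the rounding fine enough, and `μ ≤ m * B`, which makes the cap high enough.
  obtain ⟨g₀, hg₀, hmax⟩ := Finset.exists_max_image _ (I.value i) hne
  set B := I.value i g₀ with hB
  have habs : ∀ g, |I.value i g| = I.value i g := fun g => abs_of_nonneg (hI i g)
  have hB0 : 0 ≤ B := hI i g₀
  have hBμ : B ≤ μ := by
    rw [← hk₀]; exact Finset.single_le_sum (f := I.value i) (fun g _ => hI i g) hg₀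
  have hcard : ∀ S : Finset (Fin m), (S.card : ℝ) ≤ m := fun S => by
    exact_mod_cast (Finset.card_le_univ S).trans (by simp)
  have hμB : μ ≤ m * B := by
    rw [← hk₀]
    calc I.valuation i (Allocation.bundle P k₀) ≤ (Allocation.bundle P k₀).card • B :=
          Finset.sum_le_card_nsmul _ _ _ hmax
      _ ≤ m * B := by rw [nsmul_eq_mul]; exact mul_le_mul_of_nonneg_right (hcard _) hB0
  have hm' : (0 : ℝ) < m := by exact_mod_cast hm
  have hN0 : (0 : ℝ) < N := by
    rcases Nat.eq_zero_or_pos N with h | h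
    · rw [h] at hN; simp at hN; omega
    · exact_mod_cast h
  have hε : 0 < ε := by
    by_contra h
    have := mul_nonneg hN0.le (neg_nonneg.2 (not_lt.1 h))
    linarith
  obtain ⟨A', hA', hbest⟩ := hA g₀ P hP
  obtain ⟨k', hk'⟩ := hbest k
  refine le_trans ?_ hk'
  -- Rounding down underestimates goods, so the rounded value, which `A'` shares with `P`, bounds
  -- the true value of the bundle of `A'` from below.
  have h1 : B * ∑ g ∈ Allocation.bundle P k', (r g₀ g : ℝ) ≤
      N * I.valuation i (A'.bundle k') := by
    have : (∑ g ∈ Allocation.bundle P k', (r g₀ g : ℝ)) = ∑ g ∈ A'.bundle k', (r g₀ g : ℝ) := by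
      exact_mod_cast (hA' k').symm
    rw [this, Instance.valuation, Finset.mul_sum, Finset.mul_sum]
    refine Finset.sum_le_sum fun g _ => ?_
    have := (hr g₀ g).2.1
    rw [habs, habs] at this
    linarith
  suffices h2 : N * ((1 - ε) * μ) ≤ B * ∑ g ∈ Allocation.bundle P k', (r g₀ g : ℝ) from
    le_of_mul_le_mul_left (h2.trans h1) hN0
  -- One capped item contributes `B * (m * N + 1) ≥ N * (m * B) ≥ N * μ`, so this bundle needs no
  -- error estimate.
  by_cases hcap : ∃ g ∈ Allocation.bundle P k', r g₀ g = m * N + 1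
  · obtain ⟨g, hg, hgr⟩ := hcap
    have h3 : (r g₀ g : ℝ) ≤ ∑ g ∈ Allocation.bundle P k', (r g₀ g : ℝ) :=
      Finset.single_le_sum (f := fun g => (r g₀ g : ℝ)) (fun _ _ => Nat.cast_nonneg _) hg
    rw [hgr] at h3
    push_cast at h3
    calc N * ((1 - ε) * μ) ≤ N * (1 * μ) := by gcongr; linarith
      _ ≤ N * (m * B) := by rw [one_mul]; gcongr
      _ ≤ B * (m * N + 1) := by linarith
      _ ≤ _ := by gcongr
  · push Not at hcap
    have h3 : ∀ g ∈ Allocation.bundle P k', N * I.value i g - B ≤ B * r g₀ g := by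
      intro g hg
      have := (hr g₀ g).2.2 (lt_of_le_of_ne (hr g₀ g).1 (hcap g hg))
      rw [habs, habs] at this
      linarith
    have h4 := Finset.sum_le_sum h3
    rw [Finset.sum_sub_distrib, ← Finset.mul_sum, ← Finset.mul_sum, Finset.sum_const,
      nsmul_eq_mul] at h4
    refine le_trans ?_ h4
    have h5 : N * μ ≤ N * ∑ g ∈ Allocation.bundle P k', I.value i g :=
      mul_le_mul_of_nonneg_left (hle k') hN0.le
    -- The total loss, scaled by `N`: at most `B` per item, hence at most `m * μ ≤ N * ε * μ`.
    have h6 : ((Allocation.bundle P k').card : ℝ) * B ≤ N * ε * μ :=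
      calc _ ≤ (m : ℝ) * μ := mul_le_mul (hcard _) hBμ hB0 hm'.le
        _ ≤ _ := by gcongr
    linarith

/-- The guarantee for chores. -/
theorem chores_guarantee (hI : I.IsChores) (hm : 0 < m) (hN : (m : ℝ) ≤ N * ε)
    (hr : ∀ g g', IsRound N (m * N + 1) |I.value i g| |I.value i g'| (r g g'))
    (hA : ∀ g P, I.Feasible P → ∃ A' : Allocation n m,
      (∀ k, ∑ g' ∈ A'.bundle k, r g g' = ∑ g' ∈ Allocation.bundle P k, r g g') ∧
      ∀ k, ∃ k', I.valuation i (A'.bundle k') ≤ I.valuation i (A.bundle k)) (k : Fin n) :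
    (1 + ε) * I.mms i ≤ I.valuation i (A.bundle k) := by
  obtain ⟨P, hP, hle, -⟩ := I.exists_feasible_mms i
  set μ := I.mms i with hμ
  have habs : ∀ g, |I.value i g| = -I.value i g := fun g => abs_of_nonpos (hI i g)
  -- The right guess is the worst chore overall. Every allocation puts it into some bundle, whence
  -- `μ ≤ -B`.
  obtain ⟨g₀, -, hmin⟩ := Finset.exists_min_image Finset.univ (I.value i) ⟨⟨0, hm⟩, by simp⟩
  set B := -I.value i g₀ with hB
  have hB0 : 0 ≤ B := neg_nonneg.2 (hI i g₀)
  have hgB : ∀ g, -I.value i g ≤ B := fun g => neg_le_neg (hmin g (Finset.mem_univ g))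
  have hcard : ∀ S : Finset (Fin m), (S.card : ℝ) ≤ m := fun S => by
    exact_mod_cast (Finset.card_le_univ S).trans (by simp)
  have hm' : (0 : ℝ) < m := by exact_mod_cast hm
  have hN0 : (0 : ℝ) < N := by
    rcases Nat.eq_zero_or_pos N with h | h
    · rw [h] at hN; simp at hN; omega
    · exact_mod_cast h
  have hBμ : μ ≤ -B := by
    refine (hle (P g₀)).trans ?_
    have := Finset.single_le_sum (f := fun g => -I.value i g)
      (fun g _ => neg_nonneg.2 (hI i g)) (show g₀ ∈ Allocation.bundle P (P g₀) by
        simp [Allocation.bundle])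
    rw [Finset.sum_neg_distrib] at this
    unfold Instance.valuation
    linarith
  obtain ⟨A', hA', hbest⟩ := hA g₀ P hP
  obtain ⟨k', hk'⟩ := hbest k
  refine le_trans ?_ hk'
  -- The cap never interferes if `B > 0`: as `B` is the largest absolute value, `r ≤ N < m * N + 1`.
  -- If `B = 0`, all values vanish.
  have hup : ∀ g, -(N * I.value i g) ≤ B * r g₀ g + B := by
    intro g
    obtain ⟨h1, h2, h3⟩ := hr g₀ g
    rw [habs, habs, ← hB] at h2 h3
    rcases hB0.eq_or_lt with h | h
    · have : -I.value i g = 0 := le_antisymm (h ▸ hgB g) (neg_nonneg.2 (hI i g))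
      have : I.value i g = 0 := by linarith
      rw [this, ← h]; simp
    · have : (r g₀ g : ℝ) ≤ N :=
        le_of_mul_le_mul_right (h2.trans (mul_le_mul_of_nonneg_left (hgB g) hN0.le)) h
      have h4 : r g₀ g ≤ N := by exact_mod_cast this
      have h5 : N ≤ m * N := Nat.le_mul_of_pos_left N hm
      have := h3 (by omega)
      linarith
  have h1 : -(N * I.valuation i (A'.bundle k')) ≤
      B * ∑ g ∈ Allocation.bundle P k', (r g₀ g : ℝ) + m * B := by
    have e : (∑ g ∈ Allocation.bundle P k', (r g₀ g : ℝ)) = ∑ g ∈ A'.bundle k', (r g₀ g : ℝ) := by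
      exact_mod_cast (hA' k').symm
    have := Finset.sum_le_sum fun g (_ : g ∈ A'.bundle k') => hup g
    rw [Finset.sum_neg_distrib, ← Finset.mul_sum, Finset.sum_add_distrib, ← Finset.mul_sum,
      Finset.sum_const, nsmul_eq_mul] at this
    rw [e]
    have h2 := mul_le_mul_of_nonneg_right (hcard (A'.bundle k')) hB0
    unfold Instance.valuation
    linarith
  -- The two directions of rounding are used on different allocations: the error term is paid on
  -- `A'`, while on `P` rounding down costs nothing.
  have h2 : B * ∑ g ∈ Allocation.bundle P k', (r g₀ g : ℝ) ≤
      -(N * I.valuation i (Allocation.bundle P k')) := by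
    rw [Instance.valuation, Finset.mul_sum, Finset.mul_sum, ← Finset.sum_neg_distrib]
    refine Finset.sum_le_sum fun g _ => ?_
    have := (hr g₀ g).2.1
    rw [habs, habs, ← hB] at this
    linarith
  have h3 : N * μ ≤ N * I.valuation i (Allocation.bundle P k') :=
    mul_le_mul_of_nonneg_left (hle k') hN0.le
  have h4 : m * B ≤ N * ε * -μ := mul_le_mul hN (by linarith) hB0 (hm'.le.trans hN)
  refine le_of_mul_le_mul_left ?_ hN0
  linarith

end guarantee

end QuotaMMS

namespace QuotaMMS

open Program

/-! ### Arrays changed by each phase, and the run of the whole program -/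

section phases

variable {n ℓ : ℕ} (a : ℕ)

@[simp] theorem modNat_scale : scale.ModNat a ↔ a = 5 ∨ a = 6 := by
  simp [scale, scaleBody]; tauto

@[simp] theorem modReal_scale : scale.ModReal a ↔ a = 2 := by
  simp [scale, scaleBody]

@[simp] theorem modNat_absValues : absValues.ModNat a ↔ a = 13 := by
  simp [absValues]

@[simp] theorem modReal_absValues : absValues.ModReal a ↔ a = 3 := by
  simp [absValues]

@[simp] theorem modNat_roundValues :
    roundValues.ModNat a ↔ a = 13 ∨ a = 14 ∨ a = 15 ∨ a = 16 ∨ a = 7 := by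
  simp [roundValues, roundCell_modNat]

@[simp] theorem modReal_roundValues : roundValues.ModReal a ↔ a = 4 ∨ a = 5 := by
  simp [roundValues, roundCell_modReal]

theorem modNat_initStates (h : (initStates n ℓ).ModNat a) :
    a = 8 ∨ a = 10 ∨ a = 11 ∨ a = 13 := by
  simp [initStates] at h; tauto

theorem modReal_initStates (h : (initStates n ℓ).ModReal a) : a = 6 := by
  simp [initStates] at h; tauto

theorem modNat_expandStates (h : (expandStates n ℓ).ModNat a) :
    a = 8 ∨ a = 9 ∨ a = 10 ∨ a = 11 ∨ a = 12 ∨ a = 13 := by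
  simp [expandStates] at h; tauto

@[simp] theorem modNat_selectState : (selectState n ℓ).ModNat a ↔ a = 17 ∨ a = 13 := by
  simp [selectState]; tauto

@[simp] theorem modReal_selectState : ¬ (selectState n ℓ).ModReal a := by
  simp [selectState]

@[simp] theorem modNat_outputState : outputState.ModNat a ↔ a = 13 ∨ a = 4 := by
  simp [outputState]

@[simp] theorem modReal_outputState : ¬ outputState.ModReal a := by
  simp [outputState]

end phases

/-- Sequential composition of the phases; the frames carry the results of each phase, and the input
arrays, to the final store. The computed precision `N` is known only to be at most `⌈m / ε⌉₊`, so
the step bounds are relaxed by monotonicity. -/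
theorem runs_mmsProgram {n ℓ m : ℕ} (I : Instance n m ℓ) {ε : ℝ} (hε : 0 < ε) :
    Runs (mmsProgram n ℓ) (inputStore I ε) (mmsTime n ℓ m ⌈(m : ℝ) / ε⌉₊) (FinalStore I ε) := by
  set s₀ := inputStore I ε with hs₀
  set N₀ := ⌈(m : ℝ) / ε⌉₊ with hN₀
  have z0 : s₀.nat 0 [] = m := rfl
  have hr0 : s₀.real 0 [] = ε := rfl
  refine Runs.seq ((runs_scale (s := s₀) hε).mono (by rw [z0, hr0]) ?_)
  rintro s₁ f₁ ⟨p1, p2, p3⟩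
  rw [z0] at p1 p2 p3
  rw [hr0] at p1 p3
  set N := s₁.nat 5 [] with hN
  have d0 : s₁.nat 0 [] = m := by rw [f₁.1 0 (by simp), z0]
  have dv : s₁.real 1 = s₀.real 1 := f₁.2 1 (by simp)
  refine Runs.seq ((runs_absValues s₁).mono (by rw [d0]) ?_)
  intro s₂ f₂ q1
  rw [d0, dv] at q1
  have e0 : s₂.nat 0 [] = m := by rw [f₂.1 0 (by simp), d0]
  have e5 : s₂.nat 5 [] = N := by rw [f₂.1 5 (by simp)]
  have e6 : s₂.nat 6 [] = m * N + 1 := by rw [f₂.1 6 (by simp), p2]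
  refine Runs.seq ((runs_roundValues s₂ fun g hg => by
    rw [e0] at hg; rw [q1 g hg]; exact abs_nonneg _).mono ?_ ?_)
  · rw [e0, e5, e6]; gcongr
  intro s₃ f₃ r1
  rw [e0, e5, e6] at r1
  set cat := s₀.nat 1 with hcat
  set v := s₀.real 1 with hv
  set R := s₃.nat 7 with hR
  have g0 : s₃.nat 0 = s₀.nat 0 := by rw [f₃.1 0 (by simp), f₂.1 0 (by simp), f₁.1 0 (by simp)]
  have g1 : s₃.nat 1 = cat := by rw [f₃.1 1 (by simp), f₂.1 1 (by simp), f₁.1 1 (by simp)]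
  have gv : s₃.real 1 = v := by rw [f₃.2 1 (by simp), f₂.2 1 (by simp), f₁.2 1 (by simp)]
  refine Runs.seq ((runs_initStates (n := n) (ℓ := ℓ) (cat := cat) (R := R) (v := v) (m := m)
    (s := s₃) (by rw [g0, z0]) ?_).mono le_rfl ?_)
  · intro k
    rw [f₃.1 10 (by simp), f₂.1 10 (by simp), f₁.1 10 (by simp)]; rfl
  rintro s₄ f₄ ⟨t1, t2⟩
  have h0 : s₄.nat 0 = s₀.nat 0 := by
    rw [f₄.1 0 fun h => by simpa using modNat_initStates _ h, g0]
  have h1 : s₄.nat 1 = cat := by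
    rw [f₄.1 1 fun h => by simpa using modNat_initStates _ h, g1]
  have h7 : s₄.nat 7 = R := f₄.1 7 fun h => by simpa using modNat_initStates _ h
  have hv' : s₄.real 1 = v := by
    rw [f₄.2 1 fun h => by simpa using modReal_initStates _ h, gv]
  have hRle : ∀ g < m, ∀ g' < m, R [g, g'] ≤ m * N + 1 := fun g hg g' hg' => (r1 g hg g' hg').1
  refine Runs.seq ((runs_expandStates (k := m * N + 1) t1 (by rw [h0, z0]) h1 h7 hv' (Nat.succ_pos _) hRle).mono
    ?_ ?_)
  · simp only [Nat.cast_id]; gcongr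
  rintro s₅ f₅ ⟨u1, u2, u3⟩
  refine Runs.seq ((runs_selectState s₅).mono (T' := (m * (m * N₀ + 1) + 1) ^
    Fintype.card (Feature n ℓ) * 4 + 3) ?_ ?_)
  · have := u1.size_le (Nat.succ_pos _) hRle
    have h' : (m * (m * N + 1) + 1) ^ Fintype.card (Feature n ℓ) ≤
      (m * (m * N₀ + 1) + 1) ^ Fintype.card (Feature n ℓ) := by gcongr
    have := this.trans h'
    omega
  intro s₆ f₆ w1
  have i0 : s₅.nat 0 = s₀.nat 0 := by
    rw [f₅.1 0 fun h => by simpa using modNat_expandStates _ h, h0]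
  refine (runs_outputState s₆).mono (by rw [f₆.1 0 (by simp), i0, z0]) ?_
  intro s₇ f₇ x1
  have j : ∀ a, a ≠ 13 → a ≠ 17 → a ≠ 4 → s₇.nat a = s₅.nat a := by
    intro a ha hb hc
    rw [f₇.1 a (by simp [ha, hc]), f₆.1 a (by simp [ha, hb])]
  have j6 : s₇.real 6 = s₅.real 6 := by rw [f₇.2 6 (by simp), f₆.2 6 (by simp)]
  have j17 : s₇.nat 17 = s₆.nat 17 := f₇.1 17 (by simp)
  have j7 : s₇.nat 7 = R := by
    rw [j 7 (by simp) (by simp) (by simp),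
      f₅.1 7 fun h => by simpa using modNat_expandStates _ h, h7]
  have j11 := j 11 (by simp) (by simp) (by simp)
  have hsame : ∀ q, SameState s₅ s₇ q := by
    intro q x
    rw [j 8 (by simp) (by simp) (by simp), j 9 (by simp) (by simp) (by simp), j6]
    simp
  have hext : Extends s₅ s₇ := ⟨by rw [j11], fun q _ => hsame q⟩
  have hgood : ∀ q, s₇.Good n ℓ q ↔ s₅.Good n ℓ q := by
    intro q
    unfold Store.Good Store.feature
    rw [j 0 (by simp) (by simp) (by simp), j 2 (by simp) (by simp) (by simp),
      j 3 (by simp) (by simp) (by simp), j 8 (by simp) (by simp) (by simp)]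
  refine ⟨⟨N, p3, ?_⟩, ?_, ?_, ?_, ?_, ?_, ?_⟩
  · intro g hg g' hg'
    have := r1 g hg g' hg'
    rw [q1 g hg, q1 g' hg'] at this
    rw [j7]; exact this
  · rw [j7]
    exact u1.congr j11 (j 10 (by simp) (by simp) (by simp)) fun q _ => hsame q
  · intro g hg
    rw [j7]; exact (t2 g hg).mono (u2.trans hext)
  · intro q hq hlt i
    rw [j11] at hq
    rw [(hsame q).feature] at hlt ⊢
    rw [j7]
    exact (u3 q hq hlt i).mono hext
  · intro a ha
    rw [j a (by omega) (by omega) (by omega),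
      f₅.1 a fun h => by have := modNat_expandStates _ h; omega,
      f₄.1 a fun h => by have := modNat_initStates _ h; omega,
      f₃.1 a (by simp; omega), f₂.1 a (by simp; omega), f₁.1 a (by simp; omega)]
  · intro q hq hg
    rw [j11] at hq ⊢
    rw [hgood] at hg
    rw [hgood, j17, j6]
    exact w1 q hq hg
  · intro g hg
    rw [x1 g (by rw [f₆.1 0 (by simp), i0, z0]; exact hg), j17,
      f₇.1 9 (by simp)]

/-! ### Correctness -/

section correctness

variable {n ℓ m : ℕ} {I : Instance n m ℓ} {ε : ℝ}

/-- An allocation as a function of natural numbers. -/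
def Allocation.toNat (A : Allocation n m) (g : ℕ) : ℕ := if h : g < m then A ⟨g, h⟩ else 0

theorem Allocation.toNat_val (A : Allocation n m) (g : Fin m) : A.toNat g = A g := by
  simp [Allocation.toNat]

theorem features_count (R : List ℕ → ℕ) (g₀ : ℕ) (A : Allocation n m) (i : Fin n) (j : Fin ℓ) :
    features (n := n) ((inputStore I ε).nat 1) R g₀ m A.toNat (.inr (i, some j)) =
      (A.bundle i ∩ I.cat j).card := by
  simp only [features, initFeature, zero_add, featureStep]
  rw [← Fin.sum_univ_eq_sum_range (fun g => if (i : ℕ) = A.toNat g ∧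
    (inputStore I ε).nat 1 [g] = j then 1 else 0), Finset.sum_boole, Nat.cast_id]
  congr 1
  ext g
  simp [Allocation.bundle, Instance.cat, Allocation.toNat_val, inputStore, Fin.val_inj, eq_comm]

theorem features_round (R : List ℕ → ℕ) (g₀ : ℕ) (A : Allocation n m) (i : Fin n) :
    features (n := n) (ℓ := ℓ) ((inputStore I ε).nat 1) R g₀ m A.toNat (.inr (i, none)) =
      ∑ g ∈ A.bundle i, R [g₀, g] := by
  simp only [features, initFeature, zero_add, featureStep]
  rw [← Fin.sum_univ_eq_sum_range (fun g => if (i : ℕ) = A.toNat g then R [g₀, g] else 0),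
    Allocation.bundle, Finset.sum_filter]
  refine Finset.sum_congr rfl fun g _ => ?_
  simp [Allocation.toNat_val, Fin.val_inj, eq_comm]

theorem inputStore_value (h : 0 < n) (g : Fin m) :
    (inputStore I ε).real 1 [0, g] = I.value ⟨0, h⟩ g := by
  simp [inputStore, h]

theorem sum_range_value (h : 0 < n) (A : Allocation n m) (i : Fin n) :
    (∑ g ∈ Finset.range m, if A.toNat g = i then (inputStore I ε).real 1 [0, g] else 0) =
      I.valuation ⟨0, h⟩ (A.bundle i) := by
  rw [← Fin.sum_univ_eq_sum_range (fun g => if A.toNat g = i then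
    (inputStore I ε).real 1 [0, g] else 0), Instance.valuation, Allocation.bundle,
    Finset.sum_filter]
  refine Finset.sum_congr rfl fun g _ => ?_
  simp [Allocation.toNat_val, Fin.val_inj, inputStore_value h]

/-- A state with a complete allocation describes an allocation of the instance. -/
theorem FinalStore.exists_allocation {s : Store} (hs : FinalStore I ε s) (hn : 0 < n) {q : ℕ}
    (hq : q < s.nat 11 []) (hlev : m ≤ s.feature q (.inl true : Feature n ℓ)) :
    ∃ A : Allocation n m, (∀ g : Fin m, s.nat 9 [q, g] = A g) ∧
      (s.feature q : Feature n ℓ → ℕ) = features ((inputStore I ε).nat 1) (s.nat 7)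
        (s.feature q (.inl false : Feature n ℓ)) m A.toNat ∧
      ∀ i : Fin n, s.real 6 [q, (i : ℕ)] = I.valuation ⟨0, hn⟩ (A.bundle i) := by
  have hv := hs.queue.valid q hq
  have hm : s.feature q (.inl true : Feature n ℓ) = m := le_antisymm hv.level_le hlev
  have hlt := hv.agent_lt
  have hfe := hv.feature_eq
  have hva := hv.value_eq
  rw [hm] at hlt hfe hva
  let A : Allocation n m := fun g => ⟨s.nat 9 [q, g], hlt g g.2⟩
  have hA : ∀ g < m, s.nat 9 [q, g] = A.toNat g := fun g hg => by
    simp [Allocation.toNat, hg, A]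
  refine ⟨A, fun g => rfl, ?_, fun i => ?_⟩
  · rw [← features_congr _ _ _ _ hA]; exact hfe
  · rw [hva, ← sum_range_value (ε := ε) hn A i]
    exact Finset.sum_congr rfl fun g hg => by rw [hA g (Finset.mem_range.1 hg)]

/-- Feasibility concerns only the category counts, which are features; so all allocations with the
same features as a feasible one are feasible. -/
theorem FinalStore.good_iff {s : Store} (hs : FinalStore I ε s) {q g₀ : ℕ} {A : Allocation n m}
    (h : (s.feature q : Feature n ℓ → ℕ) =
      features ((inputStore I ε).nat 1) (s.nat 7) g₀ m A.toNat) :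
    s.Good n ℓ q ↔ I.Feasible A := by
  unfold Store.Good
  rw [h, features_level, hs.input 0 (by simp), hs.input 2 (by simp), hs.input 3 (by simp)]
  simp only [features_count]
  simp [inputStore, Instance.Feasible, Instance.FeasibleBundle]

/-- The output is a feasible allocation whose least valuable bundle is at least as good as that of
some feasible allocation with the same rounded values as `P`, for every feasible `P`. -/
theorem FinalStore.exists_output {s : Store} (hs : FinalStore I ε s) (hn : 0 < n) (hm : 0 < m) :
    ∃ A : Allocation n m, s.Outputs A ∧ I.Feasible A ∧ ∀ (g : Fin m) (P : Allocation n m),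
      I.Feasible P → ∃ A' : Allocation n m,
        (∀ k, ∑ g' ∈ A'.bundle k, s.nat 7 [(g : ℕ), (g' : ℕ)] =
          ∑ g' ∈ Allocation.bundle P k, s.nat 7 [(g : ℕ), (g' : ℕ)]) ∧
        ∀ k, ∃ k', I.valuation ⟨0, hn⟩ (A'.bundle k') ≤ I.valuation ⟨0, hn⟩ (A.bundle k) := by
  have hstate : ∀ (g : Fin m) (P : Allocation n m), I.Feasible P → ∃ q < s.nat 11 [],
      (s.feature q : Feature n ℓ → ℕ) =
        features ((inputStore I ε).nat 1) (s.nat 7) g m P.toNat ∧ s.Good n ℓ q := by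
    intro g P hP
    have hlt : ∀ g < m, P.toNat g < n := fun g hg => by
      simp [Allocation.toNat, hg]
    obtain ⟨q, hq, hf⟩ := present_features hs.init hs.closed g.2 hlt m le_rfl
    exact ⟨q, hq, hf, (hs.good_iff hf).2 hP⟩
  -- The selection is meaningful only if some good state exists; a feasible allocation provides one.
  obtain ⟨P₀, hP₀⟩ := I.exists_feasible hn
  obtain ⟨q₀, hq₀, -, hg₀⟩ := hstate ⟨0, hm⟩ P₀ hP₀
  obtain ⟨hb, hbg, -⟩ := hs.best q₀ hq₀ hg₀
  have hin : s.nat 0 [] = m := by rw [hs.input 0 (by simp)]; rfl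
  obtain ⟨A, hA, hAf, hAv⟩ := hs.exists_allocation hn hb (hin ▸ hbg.1)
  refine ⟨A, fun g => (hs.output g g.2).trans (hA g), (hs.good_iff hAf).1 hbg, ?_⟩
  intro g P hP
  obtain ⟨q, hq, hf, hg⟩ := hstate g P hP
  obtain ⟨A', -, hAf', hAv'⟩ := hs.exists_allocation hn hq (hin ▸ hg.1)
  obtain ⟨-, -, hbest⟩ := hs.best q hq hg
  refine ⟨A', fun k => ?_, fun k => ?_⟩
  -- Both sums are the same feature of the state `q`, whose guess is `g`.
  · rw [← features_round (I := I) (ε := ε), ← features_round (I := I) (ε := ε), ← hf, hAf', hf]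
    simp only [features_guess]
  · obtain ⟨k', hk'⟩ := hbest k
    exact ⟨k', by rw [← hAv k, ← hAv' k']; exact hk'⟩

end correctness

/-! ### The running time as a polynomial -/

/-- `mmsTime` is defined over any commutative semiring, so the same expression gives the step count
in `ℕ` and a polynomial; `X 0` stands for `m`, `X 1` for `ε⁻¹`, and `X 0 * X 1 + 1` dominates `⌈m /
ε⌉₊`. -/
noncomputable def timePolynomial (n ℓ : ℕ) : MvPolynomial (Fin 2) ℝ :=
  mmsTime n ℓ (.X 0) (.X 0 * .X 1 + 1)

theorem mmsTime_le_eval (n ℓ m : ℕ) {ε : ℝ} (hε : 0 < ε) :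
    ((mmsTime n ℓ m ⌈(m : ℝ) / ε⌉₊ : ℕ) : ℝ) ≤
      MvPolynomial.eval ![(m : ℝ), ε⁻¹] (timePolynomial n ℓ) := by
  have hN : (⌈(m : ℝ) / ε⌉₊ : ℝ) ≤ m * ε⁻¹ + 1 := by
    rw [← div_eq_mul_inv]; exact (Nat.ceil_lt_add_one (by positivity)).le
  have h1 : ((mmsTime n ℓ m ⌈(m : ℝ) / ε⌉₊ : ℕ) : ℝ) =
      mmsTime n ℓ (m : ℝ) (⌈(m : ℝ) / ε⌉₊ : ℝ) := by
    simp [mmsTime]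
  have h2 : MvPolynomial.eval ![(m : ℝ), ε⁻¹] (timePolynomial n ℓ) =
      mmsTime n ℓ (m : ℝ) (m * ε⁻¹ + 1) := by
    simp [mmsTime, timePolynomial]
  rw [h1, h2]
  unfold mmsTime
  dsimp only
  gcongr

theorem Instance.Identical.mms_eq {n m ℓ : ℕ} {I : Instance n m ℓ} (hI : I.Identical)
    (i i' : Fin n) : I.mms i = I.mms i' := by
  unfold Instance.mms Instance.minValues
  rw [hI i i']

/-- Everything but the error estimate is common to goods and chores, so the estimate enters as a
hypothesis. -/
theorem exists_computesMMS (n ℓ : ℕ) (IsKind : ∀ {m : ℕ}, Instance n m ℓ → Prop) (α : ℝ → ℝ)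
    (guarantee : ∀ {m : ℕ} {I : Instance n m ℓ} {ε : ℝ} {N : ℕ} {r : Fin m → Fin m → ℕ}
      {i : Fin n} {A : Allocation n m}, IsKind I → 0 < m → (m : ℝ) ≤ N * ε →
      (∀ g g', IsRound N (m * N + 1) |I.value i g| |I.value i g'| (r g g')) →
      (∀ g P, I.Feasible P → ∃ A' : Allocation n m,
        (∀ k, ∑ g' ∈ A'.bundle k, r g g' = ∑ g' ∈ Allocation.bundle P k, r g g') ∧
        ∀ k, ∃ k', I.valuation i (A'.bundle k') ≤ I.valuation i (A.bundle k)) →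
      ∀ k : Fin n, α ε * I.mms i ≤ I.valuation i (A.bundle k)) :
    ∃ (p : Program) (T : MvPolynomial (Fin 2) ℝ), ∀ (ε : ℝ), 0 < ε → ∀ (m : ℕ)
      (I : Instance n m ℓ), IsKind I → I.Identical →
        p.ComputesMMS I ε (α ε) (MvPolynomial.eval ![(m : ℝ), ε⁻¹] T) := by
  refine ⟨mmsProgram n ℓ, timePolynomial n ℓ, fun ε hε m I hI hid => ?_⟩
  obtain ⟨t, s, hexec, ht, hs⟩ := runs_mmsProgram I hε
  suffices h : ∃ A : Allocation n m, s.Outputs A ∧ I.IsApproxMMS (α ε) A by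
    obtain ⟨A, hA, hA'⟩ := h
    exact ⟨t, s, A, hexec, le_trans (by exact_mod_cast ht) (mmsTime_le_eval n ℓ m hε), hA, hA'⟩
  -- Without items there is no guess to initialize a state, but the only allocation is the empty one
  -- and all bundles are worth `0`.
  rcases Nat.eq_zero_or_pos m with rfl | hm
  · refine ⟨finZeroElim, fun g => Fin.elim0 g, ?_, fun i => ?_⟩
    · intro i
      obtain ⟨P, hP⟩ := I.exists_feasible (Fin.pos i)
      rw [Subsingleton.elim (finZeroElim : Allocation n 0) P]; exact hP i
    · obtain ⟨P, -, -, k, hk⟩ := I.exists_feasible_mms i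
      have h0 : ∀ S, I.valuation i S = 0 := fun S => by
        rw [Subsingleton.elim S ∅]; simp [Instance.valuation]
      rw [← hk, h0, h0, mul_zero]
  -- With no agents, the upper quota would force the category of an existing item to be empty.
  · have hn : 0 < n := by
      rcases Nat.eq_zero_or_pos n with rfl | hn
      · have h := I.le_upper_mul (I.category ⟨0, hm⟩)
        rw [mul_zero, Nat.le_zero, Finset.card_eq_zero] at h
        exact absurd rfl (Finset.filter_eq_empty_iff.1 h (Finset.mem_univ _))
      · exact hn
    obtain ⟨A, hA, hAf, hAb⟩ := hs.exists_output hn hm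
    obtain ⟨N, hN, hr⟩ := hs.exists_precision
    refine ⟨A, hA, hAf, fun i => ?_⟩
    -- The program reads only the values of the first agent.
    rw [hid i ⟨0, hn⟩, hid.mms_eq i ⟨0, hn⟩]
    refine guarantee hI hm hN (r := fun g g' => s.nat 7 [(g : ℕ), (g' : ℕ)]) ?_ hAb i
    intro g g'
    have := hr g g.2 g' g'.2
    rwa [inputStore_value hn, inputStore_value hn] at this

end QuotaMMS

theorem mainTheorem8 (n ℓ : ℕ) :
    (∃ (p : QuotaMMS.Program) (T : MvPolynomial (Fin 2) ℝ),
      ∀ (ε : ℝ), 0 < ε → ∀ (m : ℕ) (I : QuotaMMS.Instance n m ℓ), I.IsGoods → I.Identical →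
        p.ComputesMMS I ε (1 - ε) (MvPolynomial.eval ![(m : ℝ), ε⁻¹] T)) ∧
    (∃ (p : QuotaMMS.Program) (T : MvPolynomial (Fin 2) ℝ),
      ∀ (ε : ℝ), 0 < ε → ∀ (m : ℕ) (I : QuotaMMS.Instance n m ℓ), I.IsChores → I.Identical →
        p.ComputesMMS I ε (1 + ε) (MvPolynomial.eval ![(m : ℝ), ε⁻¹] T)) :=
  ⟨QuotaMMS.exists_computesMMS n ℓ (fun I => I.IsGoods) (fun ε => 1 - ε)
      QuotaMMS.goods_guarantee,
    QuotaMMS.exists_computesMMS n ℓ (fun I => I.IsChores) (fun ε => 1 + ε)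
      QuotaMMS.chores_guarantee⟩
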